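/- Let $(R,\mathfrak m)$ be a regular local ring of dimension $n$ and prime characteristic $p>0$ which is $F$-finite (the Frobenius map $R\to R$, $a\mapsto a^p$, is finite), and let $f\in R$ be nonzero. Let $E_R$ be an injective hull of the residue field $R/\mathfrak m$. Then $E_R\simeq H^n_{\mathfrak m}(R)$, and through such an isomorphism $E_R$ carries a natural $p$-linear structure $F\colon E_R\to E_R$ (an additive map with $F(az)=a^pF(z)$ for $a\in R$): if $x_1,\dots,x_n$ is a regular system of parameters, then on $$H^n_{\mathfrak m}(R)=R_{x_1\cdots x_n}\Big/\sum_{i=1}^n R_{x_1\cdots\widehat{x_i}\cdots x_n}$$ it is given by $$\left[\frac{r}{x_1^{j_1}\cdots x_n^{j_n}}\right]\mapsto\left[\frac{r^p}{x_1^{pj_1}\cdots x_n^{pj_n}}\right].$$ For every such $F$ (that is, for every choice of the parameters and of the isomorphism) and every integer $i\ge 1$, put $N_i=\{z\in E_R\mid (f^{p-1}F)^i(z)=0\}$. Then $$\mathrm{Ann}_R(N_i)=\tau\!\left(f^{(p^i-1)/p^i}\right).$$ Here, for an ideal $\mathfrak b$ of $R$ and $e\ge 1$, $\mathfrak b^{[1/p^e]}$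 denotes the smallest ideal $J$ with $\mathfrak b\subseteq J^{[p^e]}=(h^{p^e}\mid h\in J)$, and for a real number $\lambda\ge 0$ the test ideal $\tau(f^\lambda)$ is the ideal $\left((f)^{\lceil\lambda p^e\rceil}\right)^{[1/p^e]}$ for all sufficiently large $e$ (existence of these ideals for $\lambda=(p^i-1)/p^i$ and $e\gg 0$, and independence of $e\gg0$, being part of the assertion). -/

import Mathlib

open Filter

universe u

noncomputable section

/-- `ι : M → E` exhibits `E` as an injective hull of `M`: `E` is an injective module and `ι` is an
essential embedding (every nonzero submodule of `E` meets the image of `M` nontrivially). -/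
structure IsInjectiveHull (R : Type*) [CommRing R] {M E : Type*} [AddCommGroup M] [Module R M]
    [AddCommGroup E] [Module R E] (ι : M →ₗ[R] E) : Prop where
  injective_module : Module.Injective R E
  injective_map : Function.Injective ι
  essential : ∀ N : Submodule R E, N ⊓ LinearMap.range ι = ⊥ → N = ⊥

section Cech

variable {R : Type*} [CommRing R] {n : ℕ}

/-- The localization `R_{x₁⋯xₙ}`. -/
abbrev CechTerm (x : Fin n → R) : Type _ := Localization.Away (∏ j, x j)

/-- The submodule `∑ᵢ R_{x₁⋯x̂ᵢ⋯xₙ}` (more precisely, the sum of the images of these localizations)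
of `R_{x₁⋯xₙ}`. As `a := ∏_{j ≠ i} xⱼ` is invertible in `R_{x₁⋯xₙ}`, the equation
`a ^ k • z = r` says that `z = r / a ^ k`. -/
def cechBoundaries (x : Fin n → R) : Submodule R (CechTerm x) :=
  ⨆ i : Fin n, Submodule.span R
    {z | ∃ (k : ℕ) (r : R),
      (∏ j ∈ Finset.univ.erase i, x j) ^ k • z = algebraMap R (CechTerm x) r}

/-- The top local cohomology module `Hⁿ` with support in `(x₁, …, xₙ)`, as the top cohomology
`R_{x₁⋯xₙ} / ∑ᵢ R_{x₁⋯x̂ᵢ⋯xₙ}` of the Čech complex. -/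
abbrev TopLocalCohomology (x : Fin n → R) : Type _ := CechTerm x ⧸ cechBoundaries x

variable (p : ℕ) [Fact p.Prime] [CharP R p]

theorem powers_le_comap_frobenius (a : R) :
    Submonoid.powers a ≤ (Submonoid.powers a).comap (frobenius R p) := by
  rintro _ ⟨k, rfl⟩
  exact ⟨k * p, by simp [frobenius_def, pow_mul]⟩

/-- The `p`-linear map `r / s ↦ r ^ p / s ^ p` of `R_{x₁⋯xₙ}`. -/
def cechTermFrobenius (x : Fin n → R) : CechTerm x →ₛₗ[frobenius R p] CechTerm x where
  toFun := IsLocalization.map (M := Submonoid.powers (∏ j, x j))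
    (T := Submonoid.powers (∏ j, x j)) (CechTerm x) (frobenius R p)
    (powers_le_comap_frobenius p _)
  map_add' := map_add _
  map_smul' r z := by
    rw [Algebra.smul_def, map_mul, IsLocalization.map_eq, Algebra.smul_def]

theorem cechTermFrobenius_algebraMap (x : Fin n → R) (r : R) :
    cechTermFrobenius p x (algebraMap R _ r) = algebraMap R _ (r ^ p) :=
  IsLocalization.map_eq (powers_le_comap_frobenius p (∏ j, x j)) r

theorem cechBoundaries_le_comap (x : Fin n → R) :
    cechBoundaries x ≤ (cechBoundaries x).comap (cechTermFrobenius p x) := by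
  refine iSup_le fun i => Submodule.span_le.2 ?_
  rintro z ⟨k, r, hz⟩
  refine (le_iSup (fun i : Fin n => Submodule.span R
    {z | ∃ (k : ℕ) (r : R),
      (∏ j ∈ Finset.univ.erase i, x j) ^ k • z = algebraMap R (CechTerm x) r}) i)
    (Submodule.subset_span ⟨k * p, r ^ p, ?_⟩)
  rw [← cechTermFrobenius_algebraMap, ← hz, LinearMap.map_smulₛₗ, frobenius_def, pow_mul]

/-- The natural Frobenius action on the top local cohomology module,
`[r / (x₁^{j₁} ⋯ xₙ^{jₙ})] ↦ [r ^ p / (x₁^{p j₁} ⋯ xₙ^{p jₙ})]`. -/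
def topLocalCohomologyFrobenius (x : Fin n → R) :
    TopLocalCohomology x →ₛₗ[frobenius R p] TopLocalCohomology x :=
  Submodule.mapQ _ _ (cechTermFrobenius p x) (cechBoundaries_le_comap p x)

end Cech

section PLinear

variable {R : Type*} [CommRing R] (p : ℕ) [Fact p.Prime] [CharP R p]
  {E : Type*} [AddCommGroup E] [Module R E]

/-- `F` is the natural `p`-linear structure on the injective hull `E` of the residue field of the
regular local ring `R`: it corresponds to the Frobenius action on `Hⁿ_𝔪(R)`, `n = dim R`, under an
isomorphism `E ≃ Hⁿ_𝔪(R)`, where `Hⁿ_𝔪(R)` is computed by a regular system of parameters. -/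
def IsNaturalPLinearStructure [IsLocalRing R] (F : E →ₛₗ[frobenius R p] E) : Prop :=
  ∃ (n : ℕ) (x : Fin n → R), ringKrullDim R = n ∧
    Ideal.span (Set.range x) = IsLocalRing.maximalIdeal R ∧
    ∃ φ : E ≃ₗ[R] TopLocalCohomology x, ∀ z, φ (F z) = topLocalCohomologyFrobenius p x (φ z)

variable {p}

/-- For a `p`-linear map `ψ`, the submodule `{z | ψ^i z = 0}`. -/
def iterateKer (ψ : E →ₛₗ[frobenius R p] E) (i : ℕ) : Submodule R E where
  carrier := {z | ψ^[i] z = 0}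
  zero_mem' := iterate_map_zero ψ i
  add_mem' {a b} ha hb := by
    simp only [Set.mem_ofPred_eq] at ha hb ⊢
    rw [iterate_map_add, ha, hb, add_zero]
  smul_mem' c z hz := by
    have key : ∀ (k : ℕ) (c : R), ∃ d : R, ψ^[k] (c • z) = d • ψ^[k] z := by
      intro k
      induction k with
      | zero => exact fun c => ⟨c, rfl⟩
      | succ k ih =>
        intro c
        obtain ⟨d, hd⟩ := ih c
        exact ⟨frobenius R p d, by
          rw [Function.iterate_succ_apply', hd, LinearMap.map_smulₛₗ,
            Function.iterate_succ_apply']⟩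
    simp only [Set.mem_ofPred_eq] at hz ⊢
    obtain ⟨d, hd⟩ := key i c
    rw [hd, hz, smul_zero]

end PLinear

section TestIdeal

variable {R : Type*} [CommRing R]

/-- The Frobenius power `J^{[q]} = (h ^ q | h ∈ J)`. -/
def frobeniusPower (J : Ideal R) (q : ℕ) : Ideal R :=
  Ideal.span ((fun h => h ^ q) '' (J : Set R))

/-- `J = 𝔟^{[1/q]}`: `J` is the smallest ideal with `𝔟 ⊆ J^{[q]}`. -/
def IsFrobeniusRoot (b : Ideal R) (q : ℕ) (J : Ideal R) : Prop :=
  IsLeast {K : Ideal R | b ≤ frobeniusPower K q} J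

/-- `J = τ(𝔞^c)`: for `e ≫ 0` the ideal `(𝔞^{⌈c p^e⌉})^{[1/p^e]}` is equal to `J`. -/
def IsTestIdeal (p : ℕ) (a : Ideal R) (c : ℝ) (J : Ideal R) : Prop :=
  ∀ᶠ e : ℕ in atTop, IsFrobeniusRoot (a ^ ⌈c * (p : ℝ) ^ e⌉₊) (p ^ e) J

/-- The test ideal is unique. -/
theorem IsTestIdeal.unique {p : ℕ} {a : Ideal R} {c : ℝ} {J K : Ideal R}
    (hJ : IsTestIdeal p a c J) (hK : IsTestIdeal p a c K) : J = K := by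
  obtain ⟨e, h₁, h₂⟩ := (hJ.and hK).exists
  exact IsLeast.unique h₁ h₂

end TestIdeal

end

/-! Write `q = p ^ e`. A regular system of parameters acts as a regular sequence in every order,
also after raising it to powers, so `R`, viewed as a finite module over itself through the `e`-th
Frobenius, is free, with some basis `b`. Expanding `g = ∑ c_j ^ q * b_j` gives `g • F^e z = ∑ b_j •
F^e (c_j • z)`. On `Hⁿ` this sum vanishes only if every `c_j • z` does, because classes there are
compared by membership in `(x_i ^ t)`, and a basis expansion lying in the Frobenius power of an
ideal has its coefficients in that ideal. Hence `{z | g • F^e z = 0}` is the submodule of `E` killed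
by the `c_j`. As `E` is a cogenerator, its annihilator is `(c_j)`, which is exactly the Frobenius
root of `(g)`.

For the theorem, `(f^(p-1) F)^i = f^(p^i-1) F^i`. When `e = i + k`, the exponent in the test ideal
is `(p^i-1) p^k`, and `f^((p^i-1)p^k) F^(i+k) = F^k ∘ (f^(p^i-1) F^i)`. Since `F^k` is injective,
every `e ≥ i` yields the same kernel `N_i`, hence the same root.

The main lemmas are `exists_basis_of_regular`, `IsStronglyRegular.cechFrac_eq_zero_iff`,
`IsFrobeniusBasis.eq_zero_of_sum_cechFrac_eq_zero` and `IsInjectiveHull.exists_smul_ne_zero`. That a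
natural `F` exists at all rests on `E ≃ Hⁿ`, proved with the socle and the first Koszul cohomology
of `Hⁿ`. -/

/-! ### Regular local rings are domains. -/

open IsLocalRing in
theorem ringKrullDim_le_card_of_span_eq {A : Type*} [CommRing A] [IsLocalRing A]
    [IsNoetherianRing A] (s : Finset A) (hs : Ideal.span (s : Set A) = maximalIdeal A) :
    ringKrullDim A ≤ s.card := by
  refine (ringKrullDim_le_spanFinrank_maximalIdeal A).trans ?_
  rw [← hs]
  have := Submodule.spanFinrank_span_le_ncard_of_finite (R := A) (s := (s : Set A)) s.finite_toSet
  rw [Set.ncard_coe_finset] at this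
  exact_mod_cast this

-- Prime avoidance, which tolerates the one non-prime ideal `𝔪²`. If `𝔪 ≤ 𝔪²`, Nakayama gives `𝔪 =
-- 0`; if `𝔪` lies in a minimal prime, its height is zero. Both contradict the dimension.
open IsLocalRing in
theorem exists_mem_maximalIdeal_notMem_sq_notMem_minimalPrimes {A : Type*} [CommRing A]
    [IsLocalRing A] [IsNoetherianRing A] (hdim : ringKrullDim A ≠ 0) :
    ∃ a ∈ maximalIdeal A, a ∉ maximalIdeal A ^ 2 ∧ ∀ P ∈ minimalPrimes A, a ∉ P := by
  by_contra! h
  have hfin : (insert (maximalIdeal A ^ 2) (minimalPrimes A)).Finite :=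
    (minimalPrimes.finite_of_isNoetherianRing A).insert _
  have hsub : (maximalIdeal A : Set A) ⊆
      ⋃ I ∈ insert (maximalIdeal A ^ 2) (minimalPrimes A), ((id I : Ideal A) : Set A) := by
    intro a ha
    by_cases h2 : a ∈ maximalIdeal A ^ 2
    · exact Set.mem_biUnion (Set.mem_insert _ _) h2
    · obtain ⟨P, hP, haP⟩ := h a ha h2
      exact Set.mem_biUnion (Set.mem_insert_of_mem _ hP) haP
  rw [Ideal.subset_union_prime_finite hfin (maximalIdeal A ^ 2) (maximalIdeal A ^ 2)] at hsub
  · have hzero : ¬ ∃ P ∈ minimalPrimes A, maximalIdeal A ≤ P := by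
      rintro ⟨P, hP, hle⟩
      have hPp : P.IsPrime := hP.1.1
      have : P = maximalIdeal A := le_antisymm (le_maximalIdeal hPp.ne_top) hle
      apply hdim
      rw [← maximalIdeal_height_eq_ringKrullDim, Ideal.height_eq_zero_iff.2 (this ▸ hP)]
      rfl
    obtain ⟨I, hI, hle⟩ := hsub
    rcases hI with rfl | hI
    · have hbot : maximalIdeal A = ⊥ := by
        refine Submodule.eq_bot_of_le_smul_of_le_jacobson_bot (maximalIdeal A) _
          (IsNoetherian.noetherian _) ?_ (maximalIdeal_le_jacobson _)
        rw [smul_eq_mul, ← pow_two]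
        exact hle
      obtain ⟨P, hP⟩ := Ideal.nonempty_minimalPrimes (I := (⊥ : Ideal A)) bot_ne_top
      exact hzero ⟨P, hP, hbot ▸ bot_le⟩
    · exact hzero ⟨I, hI, hle⟩
  · intro I hI h1 _
    exact (hI.resolve_left h1).1.1

-- Exchange: in an expansion of `a` in the generators some coefficient is a unit, since otherwise `a
-- ∈ 𝔪²`.
open IsLocalRing in
theorem exists_span_insert_erase_eq_maximalIdeal {A : Type*} [CommRing A] [IsLocalRing A]
    [DecidableEq A] {s : Finset A} (hs : Ideal.span (s : Set A) = maximalIdeal A) {a : A}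
    (ha : a ∈ maximalIdeal A) (ha2 : a ∉ maximalIdeal A ^ 2) :
    ∃ y ∈ s, Ideal.span ((insert a (s.erase y) : Finset A) : Set A) = maximalIdeal A := by
  have ha' := ha
  rw [← hs, Submodule.mem_span_finset] at ha'
  obtain ⟨c, -, hc⟩ := ha'
  have hsm : ∀ y ∈ s, y ∈ maximalIdeal A := fun y hy => hs ▸ Ideal.subset_span hy
  obtain ⟨y, hy, hcy⟩ : ∃ y ∈ s, IsUnit (c y) := by
    by_contra! h
    apply ha2
    rw [← hc, pow_two]
    exact Ideal.sum_mem _ fun y hy => Ideal.mul_mem_mul (h y hy) (hsm y hy)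
  refine ⟨y, hy, le_antisymm ?_ ?_⟩
  · rw [Ideal.span_le]
    intro z hz
    rcases Finset.mem_insert.1 hz with rfl | hz
    · exact ha
    · exact hsm z (Finset.mem_of_mem_erase hz)
  · rw [← hs, Ideal.span_le]
    intro z hz
    by_cases hzy : z = y
    · subst hzy
      have h1 : c z * z = a - ∑ w ∈ s.erase z, c w * w := by
        rw [← hc, ← Finset.add_sum_erase s _ hy]; simp
      have h2 : c z * z ∈ Ideal.span ((insert a (s.erase z) : Finset A) : Set A) := by
        rw [h1]
        refine Ideal.sub_mem _ (Ideal.subset_span (by simp)) (Ideal.sum_mem _ fun w hw => ?_)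
        exact Ideal.mul_mem_left _ _
          (Ideal.subset_span (Finset.mem_coe.2 (Finset.mem_insert_of_mem hw)))
      exact (Ideal.unit_mul_mem_iff_mem _ hcy).1 h2
    · exact Ideal.subset_span
        (Finset.mem_coe.2 (Finset.mem_insert_of_mem (Finset.mem_erase.2 ⟨hzy, hz⟩)))

-- A minimal prime `P ⊆ (a)` not containing `a` satisfies `P = aP`, so it vanishes by Nakayama.
open IsLocalRing in
theorem isPrime_bot_of_isPrime_span_singleton {A : Type*} [CommRing A] [IsLocalRing A]
    [IsNoetherianRing A] {a : A} (ha : a ∈ maximalIdeal A) (hmin : ∀ P ∈ minimalPrimes A, a ∉ P)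
    (hprime : (Ideal.span {a}).IsPrime) : (⊥ : Ideal A).IsPrime := by
  obtain ⟨P, hP, hle⟩ := Ideal.exists_minimalPrimes_le (I := (⊥ : Ideal A)) (J := Ideal.span {a})
    bot_le
  have hPp : P.IsPrime := hP.1.1
  have : P = ⊥ := by
    refine Submodule.eq_bot_of_le_smul_of_le_jacobson_bot (Ideal.span {a}) _
      (IsNoetherian.noetherian _) ?_ ?_
    · intro z hz
      obtain ⟨w, rfl⟩ := Ideal.mem_span_singleton'.1 (hle hz)
      rw [mul_comm, smul_eq_mul]
      exact Ideal.mul_mem_mul (Ideal.mem_span_singleton_self a)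
        ((hPp.mem_or_mem hz).resolve_right (hmin P hP))
    · rw [Ideal.span_singleton_le_iff_mem]
      exact maximalIdeal_le_jacobson _ ha
  exact this ▸ hPp

open IsLocalRing in
/-- A regular local ring is a domain. -/
theorem isDomain_of_span_eq_maximalIdeal (d : ℕ) : ∀ (A : Type u) [CommRing A] [IsLocalRing A]
    [IsNoetherianRing A] (s : Finset A), Ideal.span (s : Set A) = maximalIdeal A →
    s.card ≤ d → (d : WithBot ℕ∞) ≤ ringKrullDim A → IsDomain A := by
  classical
  induction d with
  | zero =>
    intro A _ _ _ s hs hcard hdim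
    have : s = ∅ := by simpa using hcard
    subst this
    have hm : maximalIdeal A = ⊥ := by simpa using hs.symm
    exact ((isField_iff_maximalIdeal_eq).2 hm).isDomain
  | succ d ih =>
    intro A _ _ _ s hs hcard hdim
    obtain ⟨a, ha, ha2, hmin⟩ :=
      exists_mem_maximalIdeal_notMem_sq_notMem_minimalPrimes (A := A) (by
        intro h
        rw [h] at hdim
        have : ((d + 1 : ℕ) : WithBot ℕ∞) ≤ ((0 : ℕ) : WithBot ℕ∞) := hdim
        have := Nat.cast_le.1 this
        omega)
    obtain ⟨y, hy, hspan⟩ := exists_span_insert_erase_eq_maximalIdeal hs ha ha2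
    have hne : Ideal.span {a} ≠ ⊤ := by
      rw [Ne, Ideal.span_singleton_eq_top]
      exact ha
    have : Nontrivial (A ⧸ Ideal.span {a}) := Ideal.Quotient.nontrivial_iff.2 hne
    have : IsLocalRing (A ⧸ Ideal.span {a}) :=
      .of_surjective' (Ideal.Quotient.mk _) Ideal.Quotient.mk_surjective
    -- Passing to `A/(a)` removes one generator and lowers the dimension by at most one, so both
    -- numerical hypotheses survive.
    have hB : IsDomain (A ⧸ Ideal.span {a}) := by
      refine ih (A ⧸ Ideal.span {a}) ((s.erase y).image (Ideal.Quotient.mk _)) ?_ ?_ ?_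
      · rw [Finset.coe_image, ← Ideal.map_span,
          ← IsLocalRing.map_maximalIdeal_of_surjective (Ideal.Quotient.mk (Ideal.span {a}))
          Ideal.Quotient.mk_surjective, ← hspan, Finset.coe_insert, Ideal.span_insert,
          Ideal.map_sup, Ideal.map_quotient_self, bot_sup_eq]
      · refine Finset.card_image_le.trans ?_
        rw [Finset.card_erase_of_mem hy]
        omega
      · have h := ringKrullDim_le_ringKrullDim_quotient_add_card {a}
          (by simpa [IsLocalRing.ringJacobson_eq_maximalIdeal] using ha)
        rw [Finset.coe_singleton, Finset.card_singleton] at h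
        have h2 := hdim.trans h
        rw [Nat.cast_add] at h2
        exact ENat.WithBot.add_le_add_natCast_right_iff.1 h2
    have hp := isPrime_bot_of_isPrime_span_singleton ha hmin
      ((Ideal.Quotient.isDomain_iff_prime _).1 hB)
    exact IsDomain.of_bot_isPrime A

/-! ### Quotients by part of a regular system of parameters. -/

section RegularParameters

variable {R : Type u} [CommRing R] [IsLocalRing R] {n : ℕ} {x : Fin n → R}

open IsLocalRing

theorem mem_maximalIdeal_of_span_range (hx : Ideal.span (Set.range x) = maximalIdeal R)
    (i : Fin n) : x i ∈ maximalIdeal R :=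
  hx ▸ Ideal.subset_span ⟨i, rfl⟩

theorem span_image_ne_top (hx : Ideal.span (Set.range x) = maximalIdeal R) (S : Finset (Fin n)) :
    Ideal.span (x '' S) ≠ ⊤ := by
  intro h
  have : Ideal.span (x '' S) ≤ maximalIdeal R := hx ▸ Ideal.span_mono (Set.image_subset_range _ _)
  rw [h] at this
  exact (maximalIdeal.isMaximal R).ne_top (top_le_iff.1 this)

theorem dim_le_ringKrullDim_quotient_add_card [IsNoetherianRing R]
    (hx : Ideal.span (Set.range x) = maximalIdeal R)
    (hdim : ringKrullDim R = n) (S : Finset (Fin n)) :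
    (n : WithBot ℕ∞) ≤ ringKrullDim (R ⧸ Ideal.span (x '' S)) + S.card := by
  classical
  have h := ringKrullDim_le_ringKrullDim_quotient_add_card (S.image x) (by
    rw [IsLocalRing.ringJacobson_eq_maximalIdeal]
    intro z hz
    obtain ⟨i, -, rfl⟩ := Finset.mem_image.1 hz
    exact mem_maximalIdeal_of_span_range hx i)
  rw [hdim, Finset.coe_image] at h
  refine h.trans ?_
  gcongr
  exact Finset.card_image_le

theorem isLocalRing_quotient_span_image (hx : Ideal.span (Set.range x) = maximalIdeal R)
    (S : Finset (Fin n)) : IsLocalRing (R ⧸ Ideal.span (x '' S)) :=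
  have : Nontrivial (R ⧸ Ideal.span (x '' S)) :=
    Ideal.Quotient.nontrivial_iff.2 (span_image_ne_top hx S)
  .of_surjective' (Ideal.Quotient.mk _) Ideal.Quotient.mk_surjective

theorem span_image_mk_eq_maximalIdeal (S U : Finset (Fin n))
    [IsLocalRing (R ⧸ Ideal.span (x '' S))] [DecidableEq (R ⧸ Ideal.span (x '' S))]
    (hSU : Ideal.span (x '' (S ∪ U)) = maximalIdeal R) :
    Ideal.span ((U.image fun j => Ideal.Quotient.mk (Ideal.span (x '' S)) (x j) :
      Finset (R ⧸ Ideal.span (x '' S))) : Set (R ⧸ Ideal.span (x '' S))) =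
      maximalIdeal (R ⧸ Ideal.span (x '' S)) := by
  rw [← IsLocalRing.map_maximalIdeal_of_surjective (Ideal.Quotient.mk (Ideal.span (x '' S)))
    Ideal.Quotient.mk_surjective, ← hSU, Set.image_union, Ideal.span_union, Ideal.map_sup,
    Ideal.map_quotient_self, bot_sup_eq, Ideal.map_span, Finset.coe_image, ← Set.image_comp]
  rfl

theorem isDomain_quotient_span_image [IsNoetherianRing R]
    (hx : Ideal.span (Set.range x) = maximalIdeal R)
    (hdim : ringKrullDim R = n) (S : Finset (Fin n)) :
    IsDomain (R ⧸ Ideal.span (x '' S)) := by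
  classical
  have := isLocalRing_quotient_span_image hx S
  refine isDomain_of_span_eq_maximalIdeal Sᶜ.card _ _
    (span_image_mk_eq_maximalIdeal S Sᶜ ?_) Finset.card_image_le ?_
  · rw [← Finset.coe_union, Finset.union_compl, Finset.coe_univ, Set.image_univ, hx]
  · have h := dim_le_ringKrullDim_quotient_add_card hx hdim S
    have hn : n = Sᶜ.card + S.card := by
      rw [add_comm, Finset.card_add_card_compl, Fintype.card_fin]
    have h2 : ((Sᶜ.card + S.card : ℕ) : WithBot ℕ∞) ≤
        ringKrullDim (R ⧸ Ideal.span (x '' S)) + S.card := hn ▸ h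
    rw [Nat.cast_add] at h2
    exact ENat.WithBot.add_le_add_natCast_right_iff.1 h2

/-- Otherwise the maximal ideal of `R/(x_S)` would need at most `n - |S| - 1` generators, fewer than
its dimension. -/
theorem notMem_span_image [IsNoetherianRing R]
    (hx : Ideal.span (Set.range x) = maximalIdeal R)
    (hdim : ringKrullDim R = n) {S : Finset (Fin n)} {i : Fin n} (hi : i ∉ S) :
    x i ∉ Ideal.span (x '' S) := by
  classical
  intro h
  have := isLocalRing_quotient_span_image hx S
  have h1 := ringKrullDim_le_card_of_span_eq _
    (span_image_mk_eq_maximalIdeal (x := x) S (insert i S)ᶜ (by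
      rw [← hx]
      refine le_antisymm (Ideal.span_mono (Set.image_subset_range _ _)) ?_
      rw [Ideal.span_le]
      rintro _ ⟨j, rfl⟩
      by_cases hj : j = i
      · rw [hj]
        exact Ideal.span_mono (Set.image_mono Set.subset_union_left) h
      · refine Ideal.subset_span ⟨j, ?_, rfl⟩
        by_cases hjS : j ∈ S
        · exact Or.inl hjS
        · exact Or.inr (by simp [hj, hjS])))
  have h2 := dim_le_ringKrullDim_quotient_add_card hx hdim S
  have h3 : ringKrullDim (R ⧸ Ideal.span (x '' S)) ≤ ((insert i S)ᶜ.card : ℕ) :=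
    h1.trans (by exact_mod_cast Finset.card_image_le)
  have h4 : (n : WithBot ℕ∞) ≤ (((insert i S)ᶜ.card + S.card : ℕ) : WithBot ℕ∞) := by
    refine h2.trans ?_
    rw [Nat.cast_add]
    gcongr
  have h5 : n ≤ (insert i S)ᶜ.card + S.card := by exact_mod_cast h4
  have h6 := Finset.card_add_card_compl (insert i S)
  rw [Finset.card_insert_of_notMem hi, Fintype.card_fin] at h6
  omega

theorem mem_span_image_of_mul_mem [IsNoetherianRing R]
    (hx : Ideal.span (Set.range x) = maximalIdeal R)
    (hdim : ringKrullDim R = n) {S : Finset (Fin n)} {i : Fin n} (hi : i ∉ S) {r : R}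
    (h : x i * r ∈ Ideal.span (x '' S)) : r ∈ Ideal.span (x '' S) :=
  (((Ideal.Quotient.isDomain_iff_prime _).1 (isDomain_quotient_span_image hx hdim S)).mem_or_mem
    h).resolve_left (notMem_span_image hx hdim hi)

end RegularParameters

/-! ### Ideals generated by powers of a regular sequence. -/

section Powers

variable {R : Type*} [CommRing R] {ι : Type*}

/-- The ideal generated by the powers `x j ^ a j`, `j ∈ S`. -/
def powIdeal (x : ι → R) (S : Finset ι) (a : ι → ℕ) : Ideal R :=
  Ideal.span ((fun j => x j ^ a j) '' S)

theorem pow_mem_powIdeal (x : ι → R) {S : Finset ι} (a : ι → ℕ) {i : ι} (hi : i ∈ S) :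
    x i ^ a i ∈ powIdeal x S a :=
  Ideal.subset_span ⟨i, hi, rfl⟩

theorem powIdeal_le {x : ι → R} {S : Finset ι} {a : ι → ℕ} {I : Ideal R} :
    powIdeal x S a ≤ I ↔ ∀ i ∈ S, x i ^ a i ∈ I := by
  rw [powIdeal, Ideal.span_le]
  exact Set.image_subset_iff

theorem powIdeal_congr (x : ι → R) {S : Finset ι} {a b : ι → ℕ} (h : ∀ i ∈ S, a i = b i) :
    powIdeal x S a = powIdeal x S b := by
  rw [powIdeal, powIdeal, Set.image_congr fun i hi => by rw [h i hi]]

theorem powIdeal_anti (x : ι → R) {S : Finset ι} {a b : ι → ℕ} (h : ∀ i ∈ S, b i ≤ a i) :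
    powIdeal x S a ≤ powIdeal x S b :=
  powIdeal_le.2 fun i hi => Ideal.mem_of_dvd _ (pow_dvd_pow _ (h i hi)) (pow_mem_powIdeal x b hi)

variable [DecidableEq ι]

theorem powIdeal_insert (x : ι → R) (S : Finset ι) (a : ι → ℕ) (i : ι) :
    powIdeal x (insert i S) a = Ideal.span {x i ^ a i} ⊔ powIdeal x S a := by
  rw [powIdeal, Finset.coe_insert, Set.image_insert_eq, Ideal.span_insert, powIdeal]

theorem powIdeal_insert_update (x : ι → R) {S : Finset ι} (a : ι → ℕ) {i : ι} (hi : i ∉ S)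
    (k : ℕ) :
    powIdeal x (insert i S) (Function.update a i k) = Ideal.span {x i ^ k} ⊔ powIdeal x S a := by
  rw [powIdeal_insert, Function.update_self,
    powIdeal_congr x fun j hj => Function.update_of_ne (ne_of_mem_of_not_mem hj hi) k a]

/-- Every `x i` is a nonzerodivisor modulo every ideal generated by some of the other `x j`. -/
def IsStronglyRegular (x : ι → R) : Prop :=
  ∀ (S : Finset ι) (i : ι), i ∉ S → ∀ r, x i * r ∈ Ideal.span (x '' S) → r ∈ Ideal.span (x '' S)

namespace IsStronglyRegular

variable {x : ι → R} (hx : IsStronglyRegular x)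

include hx

theorem mem_powIdeal_of_mul_mem_aux (N : ℕ) : ∀ (S : Finset ι) (a : ι → ℕ), ∑ j ∈ S, a j ≤ N →
    ∀ (i : ι), i ∉ S → ∀ r, x i * r ∈ powIdeal x S a → r ∈ powIdeal x S a := by
  induction N with
  | zero =>
    intro S a hN i hi r hr
    rcases S.eq_empty_or_nonempty with rfl | ⟨j, hj⟩
    · have := hx ∅ i hi r
      simpa [powIdeal] using this (by simpa [powIdeal] using hr)
    · have h0 : a j = 0 := by
        have := Finset.single_le_sum (f := a) (fun _ _ => Nat.zero_le _) hj
        omega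
      have h1 := pow_mem_powIdeal x a hj
      rw [h0, pow_zero] at h1
      rw [(Ideal.eq_top_iff_one _).2 h1]
      trivial
  | succ N ih =>
    intro S a hN i hi r hr
    by_cases h1 : ∀ j ∈ S, a j = 1
    · have : powIdeal x S a = Ideal.span (x '' S) := by
        rw [powIdeal, Set.image_congr fun j hj => by rw [h1 j hj, pow_one]]
      rw [this] at hr ⊢
      exact hx S i hi r hr
    push Not at h1
    obtain ⟨j, hj, hj1⟩ := h1
    rcases Nat.eq_zero_or_pos (a j) with h0 | hpos
    · have h2 := pow_mem_powIdeal x a hj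
      rw [h0, pow_zero] at h2
      rw [(Ideal.eq_top_iff_one _).2 h2]
      trivial
    obtain ⟨t, ht⟩ : ∃ t, a j = t + 1 := ⟨a j - 1, by omega⟩
    obtain ⟨T, hjT, rfl⟩ : ∃ T, j ∉ T ∧ insert j T = S :=
      ⟨S.erase j, Finset.notMem_erase j S, Finset.insert_erase hj⟩
    have hsum : ∀ k, ∑ l ∈ insert j T, Function.update a j k l = k + ∑ l ∈ T, a l := by
      intro k
      rw [Finset.sum_insert hjT, Function.update_self]
      congr 1
      exact Finset.sum_congr rfl fun l hl =>
        Function.update_of_ne (ne_of_mem_of_not_mem hl hjT) k a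
    rw [Finset.sum_insert hjT] at hN
    have hiT : i ∉ T := fun h => hi (Finset.mem_insert_of_mem h)
    -- Here `a j = t + 1 ≥ 2`. Lowering this exponent gives `r = c x_j^t + z`. Comparison with `x_i
    -- r = d x_j^(t+1) + z'` and cancellation of `x_j^t` yield `x_i c ∈ (x_j) + powIdeal x T a`; by
    -- induction `c` lies there too, which restores the lost power of `x_j`.
    have hr1 : r ∈ powIdeal x (insert j T) (Function.update a j t) := by
      refine ih _ _ (by rw [hsum]; omega) i hi r (powIdeal_anti x (fun l _ => ?_) hr)
      by_cases hl : l = j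
      · subst hl; rw [Function.update_self]; omega
      · rw [Function.update_of_ne hl]
    rw [powIdeal_insert_update x a hjT, Submodule.mem_sup] at hr1
    obtain ⟨_, hy, z, hz, rfl⟩ := hr1
    obtain ⟨c, rfl⟩ := Ideal.mem_span_singleton'.1 hy
    rw [powIdeal_insert] at hr ⊢
    obtain ⟨_, hy', z', hz', hsumr⟩ := Submodule.mem_sup.1 hr
    obtain ⟨d, rfl⟩ := Ideal.mem_span_singleton'.1 hy'
    have hmem : x j ^ t * (x i * c - d * x j) ∈ powIdeal x T a := by
      have : x j ^ t * (x i * c - d * x j) = z' - x i * z := by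
        rw [ht] at hsumr
        linear_combination -hsumr
      rw [this]
      exact Ideal.sub_mem _ hz' (Ideal.mul_mem_left _ _ hz)
    have hstrip : ∀ k s, x j ^ k * s ∈ powIdeal x T a → s ∈ powIdeal x T a := by
      intro k
      induction k with
      | zero => intro s hs; simpa using hs
      | succ k ihk =>
        intro s hs
        refine ihk s (ih T a (by omega) j hjT _ ?_)
        rwa [← mul_assoc, ← pow_succ']
    have hmem2 := hstrip _ _ hmem
    have hc : c ∈ powIdeal x (insert j T) (Function.update a j 1) := by
      refine ih _ _ (by rw [hsum]; omega) i hi c ?_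
      rw [powIdeal_insert_update x a hjT]
      have : x i * c = d * x j ^ 1 + (x i * c - d * x j) := by ring
      rw [this]
      exact Submodule.add_mem_sup (Ideal.mul_mem_left _ _ (Ideal.mem_span_singleton_self _)) hmem2
    rw [powIdeal_insert_update x a hjT] at hc
    obtain ⟨_, hy'', z'', hz'', rfl⟩ := Submodule.mem_sup.1 hc
    obtain ⟨e, rfl⟩ := Ideal.mem_span_singleton'.1 hy''
    have : (e * x j ^ 1 + z'') * x j ^ t + z = e * x j ^ a j + (x j ^ t * z'' + z) := by
      rw [ht]; ring
    rw [this]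
    exact Submodule.add_mem_sup (Ideal.mul_mem_left _ _ (Ideal.mem_span_singleton_self _))
      (Ideal.add_mem _ (Ideal.mul_mem_left _ _ hz'') hz)

theorem mem_powIdeal_of_mul_mem {S : Finset ι} {a : ι → ℕ} {i : ι} (hi : i ∉ S) {r : R}
    (h : x i * r ∈ powIdeal x S a) : r ∈ powIdeal x S a :=
  hx.mem_powIdeal_of_mul_mem_aux _ S a le_rfl i hi r h

theorem mem_powIdeal_of_pow_mul_mem {S : Finset ι} {a : ι → ℕ} {i : ι} (hi : i ∉ S) (k : ℕ) {r : R}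
    (h : x i ^ k * r ∈ powIdeal x S a) : r ∈ powIdeal x S a := by
  induction k with
  | zero => simpa using h
  | succ k ih =>
    refine ih (hx.mem_powIdeal_of_mul_mem hi ?_)
    rwa [← mul_assoc, ← pow_succ']

/-- If `x i * r` lies in `(x j ^ a j)`, then `r` lies in the ideal with `a i` lowered by `1`. -/
theorem mem_powIdeal_update_of_mul_mem {S : Finset ι} {a : ι → ℕ} {i : ι} (hi : i ∈ S) {t : ℕ}
    (ht : a i = t + 1) {r : R} (h : x i * r ∈ powIdeal x S a) :
    r ∈ powIdeal x S (Function.update a i t) := by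
  obtain ⟨T, hiT, rfl⟩ : ∃ T, i ∉ T ∧ insert i T = S :=
    ⟨S.erase i, Finset.notMem_erase i S, Finset.insert_erase hi⟩
  rw [powIdeal_insert] at h
  obtain ⟨_, hy, z, hz, hsum⟩ := Submodule.mem_sup.1 h
  obtain ⟨c, rfl⟩ := Ideal.mem_span_singleton'.1 hy
  rw [powIdeal_insert_update x a hiT]
  have hr : r = c * x i ^ t + (r - c * x i ^ t) := by ring
  rw [hr]
  refine Submodule.add_mem_sup (Ideal.mul_mem_left _ _ (Ideal.mem_span_singleton_self _))
    (hx.mem_powIdeal_of_mul_mem hiT ?_)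
  have : x i * (r - c * x i ^ t) = z := by
    rw [ht] at hsum
    linear_combination -hsum
  rwa [this]

theorem mem_powIdeal_update_of_pow_mul_mem {S : Finset ι} {i : ι} (hi : i ∈ S) (k : ℕ) :
    ∀ {a : ι → ℕ} {t : ℕ}, a i = t + k → ∀ {r : R}, x i ^ k * r ∈ powIdeal x S a →
    r ∈ powIdeal x S (Function.update a i t) := by
  induction k with
  | zero =>
    intro a t ht r h
    have : Function.update a i t = a := by
      rw [show t = a i by omega, Function.update_eq_self]
    simpa [this] using h
  | succ k ih =>
    intro a t ht r h
    rw [pow_succ', mul_assoc] at h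
    have h1 := hx.mem_powIdeal_update_of_mul_mem hi (t := t + k) (by omega) h
    have h2 := ih (a := Function.update a i (t + k)) (t := t) (by simp) h1
    simpa using h2

/-- Exponents are lowered one index of `U` at a time. With `U` everything, this makes the maps
`R/(x_i^t) → R/(x_i^(t+k))` given by `(∏ x_i)^k` injective; smaller `U` serve the socle computation.
-/
theorem mem_powIdeal_of_prod_pow_mul_mem {S U : Finset ι} (hU : U ⊆ S) (k : ℕ) :
    ∀ {a : ι → ℕ} {r : R},
    (∏ i ∈ U, x i) ^ k * r ∈ powIdeal x S (fun i => if i ∈ U then a i + k else a i) →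
    r ∈ powIdeal x S a := by
  induction U using Finset.induction_on with
  | empty => intro a r h; simpa using h
  | insert i U hi ih =>
    intro a r h
    rw [Finset.prod_insert hi, mul_pow, mul_assoc] at h
    have h1 := hx.mem_powIdeal_update_of_pow_mul_mem (hU (Finset.mem_insert_self i U)) k
      (t := a i) (by simp) h
    refine ih (fun j hj => hU (Finset.mem_insert_of_mem hj)) ?_
    rwa [powIdeal_congr x (b := fun j => if j ∈ U then a j + k else a j)] at h1
    intro j _
    by_cases hji : j = i
    · subst hji; simp [hi]
    · simp [hji]

end IsStronglyRegular

end Powers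

/-! ### Freeness from a regular sequence. -/

section Freeness

open IsLocalRing

variable {R : Type*} [CommRing R] [IsLocalRing R] {M : Type*} [AddCommGroup M] [Module R M]

/-- Lift a basis of `M/𝔪M`; Nakayama gives generation. -/
theorem exists_minimal_generators [Module.Finite R M] :
    ∃ (k : ℕ) (b : Fin k → M), Submodule.span R (Set.range b) = ⊤ ∧
      ∀ c : Fin k → R, ∑ j, c j • b j ∈ maximalIdeal R • (⊤ : Submodule R M) →
        ∀ j, c j ∈ maximalIdeal R := by
  let := Ideal.Quotient.field (maximalIdeal R)
  let N : Submodule R M := maximalIdeal R • ⊤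
  have : Module.Finite (R ⧸ maximalIdeal R) (M ⧸ N) :=
    Module.Finite.of_restrictScalars_finite R (R ⧸ maximalIdeal R) (M ⧸ N)
  let B := Module.finBasis (R ⧸ maximalIdeal R) (M ⧸ N)
  choose b hb using fun j => N.mkQ_surjective (B j)
  have hmk : ∀ c : Fin _ → R,
      N.mkQ (∑ j, c j • b j) = ∑ j, Ideal.Quotient.mk (maximalIdeal R) (c j) • B j := by
    intro c
    rw [map_sum]
    refine Finset.sum_congr rfl fun j _ => ?_
    rw [map_smul, hb]
    rfl
  refine ⟨_, b, ?_, fun c hc j => ?_⟩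
  · rw [← top_le_iff]
    refine Submodule.le_of_le_smul_of_le_jacobson_bot (I := maximalIdeal R)
      Module.Finite.fg_top (maximalIdeal_le_jacobson _) fun z _ => ?_
    choose c hc using fun j => Ideal.Quotient.mk_surjective (B.repr (N.mkQ z) j)
    have hz : z - ∑ j, c j • b j ∈ N := by
      rw [← Submodule.Quotient.mk_eq_zero, ← Submodule.mkQ_apply, map_sub, hmk]
      simp_rw [hc]
      rw [B.sum_repr, sub_self]
    rw [← sub_add_cancel z (∑ j, c j • b j), add_comm]
    refine Submodule.add_mem_sup (Submodule.sum_mem _ fun j _ => ?_) hz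
    exact Submodule.smul_mem _ _ (Submodule.subset_span ⟨j, rfl⟩)
  · have h0 : N.mkQ (∑ j, c j • b j) = 0 := (Submodule.Quotient.mk_eq_zero N).2 hc
    rw [hmk] at h0
    have := Fintype.linearIndependent_iff.1 B.linearIndependent _ h0 j
    exact Ideal.Quotient.eq_zero_iff_mem.1 this

variable {n : ℕ} {x : Fin n → R}

/-- Descent from `insert i S` to `S`. Writing `c_l = x_i d_l + s_l` with `s_l ∈ I`, regularity of
`x_i` on `M/IM` makes `d` a relation modulo `I` as well. The `j`-th coefficients of all such
relations thus form an ideal contained in `I` plus `𝔪` times itself, and Nakayama places it in `I`.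
-/
theorem coeff_mem_of_sum_smul_mem [IsNoetherianRing R]
    (hx : Ideal.span (Set.range x) = maximalIdeal R) {k : ℕ}
    {b : Fin k → M} {S : Finset (Fin n)} {i : Fin n}
    (hreg : ∀ m : M, x i • m ∈ Ideal.span (x '' S) • (⊤ : Submodule R M) →
      m ∈ Ideal.span (x '' S) • (⊤ : Submodule R M))
    (hins : ∀ c : Fin k → R, ∑ j, c j • b j ∈
        Ideal.span (x '' (insert i S : Finset (Fin n))) • (⊤ : Submodule R M) →
      ∀ j, c j ∈ Ideal.span (x '' (insert i S : Finset (Fin n))))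
    (c : Fin k → R) (hc : ∑ j, c j • b j ∈ Ideal.span (x '' S) • (⊤ : Submodule R M)) (j : Fin k) :
    c j ∈ Ideal.span (x '' S) := by
  set I := Ideal.span (x '' S) with hI
  have hins' : Ideal.span (x '' (insert i S : Finset (Fin n))) = Ideal.span {x i} ⊔ I := by
    rw [Finset.coe_insert, Set.image_insert_eq, Ideal.span_insert]
  rw [hins'] at hins
  let L : Submodule R (Fin k → R) :=
    (I • (⊤ : Submodule R M)).comap (Fintype.linearCombination R b)
  have hL : ∀ c, c ∈ L ↔ ∑ j, c j • b j ∈ I • (⊤ : Submodule R M) := fun c => Iff.rfl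
  suffices h : ∀ j, L.map (LinearMap.proj j) ≤ (I : Submodule R R) from
    h j (Submodule.mem_map_of_mem (f := LinearMap.proj j) ((hL c).2 hc))
  intro j
  refine Submodule.le_of_le_smul_of_le_jacobson_bot (I := maximalIdeal R)
    (IsNoetherian.noetherian _) (maximalIdeal_le_jacobson _) ?_
  rintro _ ⟨c, hc, rfl⟩
  have hcI := hins c (Submodule.smul_mono_left le_sup_right ((hL c).1 hc))
  choose u hu s hs hus using fun l => Submodule.mem_sup.1 (hcI l)
  choose d hd using fun l => Ideal.mem_span_singleton'.1 (hu l)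
  have hdL : d ∈ L := by
    rw [hL]
    apply hreg
    have : x i • ∑ l, d l • b l = ∑ l, c l • b l - ∑ l, s l • b l := by
      rw [Finset.smul_sum, ← Finset.sum_sub_distrib]
      refine Finset.sum_congr rfl fun l _ => ?_
      rw [← hus l, ← hd l, add_smul, add_sub_cancel_right, mul_smul, smul_comm]
    rw [this]
    exact Submodule.sub_mem _ ((hL c).1 hc) (Submodule.sum_mem _ fun l _ =>
      Submodule.smul_mem_smul (hs l) trivial)
  change c j ∈ _
  rw [← hus j, ← hd j, add_comm]
  refine Submodule.add_mem_sup (hs j) ?_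
  rw [mul_comm, ← smul_eq_mul]
  exact Submodule.smul_mem_smul (hx ▸ Ideal.subset_span ⟨i, rfl⟩)
    (Submodule.mem_map_of_mem (f := LinearMap.proj j) hdL)

/-- A finite module over a Noetherian local ring, on which generators of the maximal ideal act as a
regular sequence in every order, is free. -/
theorem exists_basis_of_regular [IsNoetherianRing R] [Module.Finite R M]
    (hx : Ideal.span (Set.range x) = maximalIdeal R)
    (hreg : ∀ (S : Finset (Fin n)) (i : Fin n), i ∉ S → ∀ m : M,
      x i • m ∈ Ideal.span (x '' S) • (⊤ : Submodule R M) →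
      m ∈ Ideal.span (x '' S) • (⊤ : Submodule R M)) :
    ∃ (k : ℕ) (b : Fin k → M), Submodule.span R (Set.range b) = ⊤ ∧ LinearIndependent R b := by
  obtain ⟨k, b, hspan, hb⟩ := exists_minimal_generators (R := R) (M := M)
  refine ⟨k, b, hspan, Fintype.linearIndependent_iff.2 fun c hc j => ?_⟩
  -- The set of parameters shrinks from all of them, where the claim is minimality of `b`, to none,
  -- where it is linear independence.
  have key : ∀ U : Finset (Fin n), ∀ c : Fin k → R,
      ∑ j, c j • b j ∈ Ideal.span (x '' (Uᶜ : Finset (Fin n))) • (⊤ : Submodule R M) →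
      ∀ j, c j ∈ Ideal.span (x '' (Uᶜ : Finset (Fin n))) := by
    intro U
    induction U using Finset.induction_on with
    | empty =>
      rw [Finset.compl_empty, Finset.coe_univ, Set.image_univ, hx]
      exact hb
    | insert i U hi ih =>
      refine coeff_mem_of_sum_smul_mem hx (hreg _ i (by simp)) ?_
      have : insert i (insert i U)ᶜ = Uᶜ := by
        ext l
        by_cases hl : l = i
        · subst hl; simp [hi]
        · simp [hl]
      rwa [this]
  have := key Finset.univ c (by rw [hc]; exact Submodule.zero_mem _) j
  simpa using this

/-- Expansion along a finite ring homomorphism that is flat over a regular local ring. -/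
theorem RingHom.Finite.exists_basis_of_regular [IsNoetherianRing R]
    (hx : Ideal.span (Set.range x) = maximalIdeal R) {S : Type*} [CommRing S] (φ : R →+* S)
    (hφ : φ.Finite) (hreg : IsStronglyRegular fun i => φ (x i)) :
    ∃ (k : ℕ) (b : Fin k → S), (∀ s, ∃ c : Fin k → R, s = ∑ j, φ (c j) * b j) ∧
      ∀ c : Fin k → R, ∑ j, φ (c j) * b j = 0 → ∀ j, c j = 0 := by
  let := φ.toAlgebra
  have hfin : Module.Finite R S := hφ
  have hmem : ∀ (T : Finset (Fin n)) (s : S), s ∈ Ideal.span (x '' T) • (⊤ : Submodule R S) ↔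
      s ∈ Ideal.span ((fun i => φ (x i)) '' T) := by
    intro T s
    rw [Ideal.smul_top_eq_map, Submodule.restrictScalars_mem, Ideal.map_span, ← Set.image_comp]
    rfl
  obtain ⟨k, b, hspan, hb⟩ := _root_.exists_basis_of_regular (M := S) hx fun T i hi m hm => by
    rw [hmem] at hm ⊢
    rw [Algebra.smul_def] at hm
    exact hreg T i hi m hm
  refine ⟨k, b, fun s => ?_, fun c hc => ?_⟩
  · have hs : s ∈ Submodule.span R (Set.range b) := hspan ▸ trivial
    obtain ⟨c, hc⟩ := (Submodule.mem_span_range_iff_exists_fun R).1 hs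
    exact ⟨c, hc.symm⟩
  · exact Fintype.linearIndependent_iff.1 hb c hc

end Freeness

/-! ### Fractions in top local cohomology. -/

section CechFractions

variable {R : Type*} [CommRing R] {n : ℕ} (x : Fin n → R)

/-- The class `[r / (x₁ ⋯ xₙ) ^ t]`. -/
noncomputable def cechFrac (r : R) (t : ℕ) : TopLocalCohomology x :=
  (cechBoundaries x).mkQ
    (IsLocalization.mk' (CechTerm x) r (⟨_, t, rfl⟩ : Submonoid.powers (∏ j, x j)))

theorem prod_pow_smul_mk' (r : R) (t : ℕ) :
    (∏ j, x j) ^ t • IsLocalization.mk' (CechTerm x) r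
      (⟨_, t, rfl⟩ : Submonoid.powers (∏ j, x j)) = algebraMap R (CechTerm x) r := by
  rw [Algebra.smul_def]
  exact IsLocalization.mk'_spec' (CechTerm x) r (⟨_, t, rfl⟩ : Submonoid.powers (∏ j, x j))

theorem prod_pow_smul_injective (t : ℕ) {z w : CechTerm x}
    (h : (∏ j, x j) ^ t • z = (∏ j, x j) ^ t • w) : z = w := by
  rw [Algebra.smul_def, Algebra.smul_def] at h
  exact (IsLocalization.map_units (CechTerm x)
    (⟨_, t, rfl⟩ : Submonoid.powers (∏ j, x j))).mul_left_cancel h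

theorem eq_mk'_of_prod_pow_smul_eq {z : CechTerm x} {r : R} {t : ℕ}
    (h : (∏ j, x j) ^ t • z = algebraMap R (CechTerm x) r) :
    z = IsLocalization.mk' (CechTerm x) r (⟨_, t, rfl⟩ : Submonoid.powers (∏ j, x j)) :=
  prod_pow_smul_injective x t (h.trans (prod_pow_smul_mk' x r t).symm)

theorem exists_eq_cechFrac (z : TopLocalCohomology x) : ∃ r t, z = cechFrac x r t := by
  obtain ⟨w, rfl⟩ := (cechBoundaries x).mkQ_surjective z
  obtain ⟨r, ⟨_, t, rfl⟩, rfl⟩ := IsLocalization.exists_mk'_eq (Submonoid.powers (∏ j, x j)) w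
  exact ⟨r, t, rfl⟩

theorem smul_cechFrac (a r : R) (t : ℕ) : a • cechFrac x r t = cechFrac x (a * r) t := by
  rw [cechFrac, ← map_smul, IsLocalization.smul_mk', cechFrac]

theorem cechFrac_add (r s : R) (t : ℕ) :
    cechFrac x (r + s) t = cechFrac x r t + cechFrac x s t := by
  rw [cechFrac, cechFrac, cechFrac, ← map_add]
  congr 1
  refine (eq_mk'_of_prod_pow_smul_eq x ?_).symm
  rw [smul_add, prod_pow_smul_mk', prod_pow_smul_mk', map_add]

theorem cechFrac_zero (t : ℕ) : cechFrac x 0 t = 0 := by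
  simpa using (smul_cechFrac x 0 0 t).symm

theorem cechFrac_sum {κ : Type*} (s : Finset κ) (r : κ → R) (t : ℕ) :
    cechFrac x (∑ j ∈ s, r j) t = ∑ j ∈ s, cechFrac x (r j) t := by
  classical
  induction s using Finset.induction_on with
  | empty => simp [cechFrac_zero]
  | insert i s hi ih => rw [Finset.sum_insert hi, Finset.sum_insert hi, cechFrac_add, ih]

theorem cechFrac_mul_prod_pow (r : R) (t k : ℕ) :
    cechFrac x (r * (∏ j, x j) ^ k) (t + k) = cechFrac x r t := by
  rw [cechFrac, cechFrac]
  congr 1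
  refine (eq_mk'_of_prod_pow_smul_eq x ?_).symm
  rw [add_comm, pow_add, mul_smul, prod_pow_smul_mk', Algebra.smul_def, ← map_mul, mul_comm]

theorem exists_forall_eq_cechFrac {k : ℕ} (z : Fin k → TopLocalCohomology x) :
    ∃ (r : Fin k → R) (t : ℕ), ∀ j, z j = cechFrac x (r j) t := by
  choose r t h using fun j => exists_eq_cechFrac x (z j)
  refine ⟨fun j => r j * (∏ i, x i) ^ (∑ l, t l - t j), ∑ l, t l, fun j => ?_⟩
  have hle : t j ≤ ∑ l, t l := Finset.single_le_sum (fun _ _ => Nat.zero_le _) (Finset.mem_univ j)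
  rw [h, ← cechFrac_mul_prod_pow x (r j) (t j) (∑ l, t l - t j), Nat.add_sub_cancel' hle]

theorem prod_pow_smul_eq_pow_smul {M : Type*} [AddCommGroup M] [Module R M] (i : Fin n) (k : ℕ)
    (z : M) :
    (∏ j, x j) ^ k • z = x i ^ k • (∏ j ∈ Finset.univ.erase i, x j) ^ k • z := by
  rw [← Finset.mul_prod_erase _ _ (Finset.mem_univ i), mul_pow, mul_smul]

theorem pow_mem_cechBoundaries {z : CechTerm x} {r : R} {t : ℕ}
    (h : (∏ j, x j) ^ t • z = algebraMap R (CechTerm x) r) {i : Fin n} (hr : x i ^ t ∣ r) :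
    z ∈ cechBoundaries x := by
  obtain ⟨c, rfl⟩ := hr
  refine (le_iSup (fun i : Fin n => Submodule.span R
    {z | ∃ (k : ℕ) (r : R),
      (∏ j ∈ Finset.univ.erase i, x j) ^ k • z = algebraMap R (CechTerm x) r}) i)
    (Submodule.subset_span ⟨t, c, ?_⟩)
  have hu : IsUnit (algebraMap R (CechTerm x) (x i)) := by
    have h1 := IsLocalization.map_units (CechTerm x)
      (⟨_, Submonoid.mem_powers _⟩ : Submonoid.powers (∏ j, x j))
    exact isUnit_of_dvd_unit (map_dvd _ (Finset.dvd_prod_of_mem x (Finset.mem_univ i))) h1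
  rw [prod_pow_smul_eq_pow_smul x i, Algebra.smul_def (x i ^ t), map_mul] at h
  rw [map_pow] at h
  exact (hu.pow t).mul_left_cancel h

theorem cechFrac_eq_zero_of_mem {r : R} {t : ℕ}
    (h : r ∈ powIdeal x Finset.univ fun _ => t) : cechFrac x r t = 0 := by
  induction h using Submodule.span_induction with
  | mem r hr =>
    obtain ⟨i, -, rfl⟩ := hr
    exact (Submodule.Quotient.mk_eq_zero _).2
      (pow_mem_cechBoundaries x (prod_pow_smul_mk' x _ t) (dvd_refl _))
  | zero => exact cechFrac_zero x t
  | add r s _ _ hr hs => rw [cechFrac_add, hr, hs, add_zero]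
  | smul a r _ hr => rw [smul_eq_mul, ← smul_cechFrac, hr, smul_zero]

theorem prod_pow_mul_mem_powIdeal {r : R} {s : ℕ} (k : ℕ)
    (h : r ∈ powIdeal x Finset.univ fun _ => s) :
    (∏ j, x j) ^ k * r ∈ powIdeal x Finset.univ fun _ => k + s := by
  induction h using Submodule.span_induction with
  | mem r hr =>
    obtain ⟨i, -, rfl⟩ := hr
    refine Ideal.mem_of_dvd _ ?_
      (pow_mem_powIdeal x (fun _ => k + s) (Finset.mem_univ i))
    change x i ^ (k + s) ∣ _ * x i ^ s
    rw [pow_add]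
    exact mul_dvd_mul_right (pow_dvd_pow_of_dvd (Finset.dvd_prod_of_mem x (Finset.mem_univ i)) k) _
  | zero => rw [mul_zero]; exact Ideal.zero_mem _
  | add r s _ _ hr hs => rw [mul_add]; exact Ideal.add_mem _ hr hs
  | smul a r _ hr => rw [smul_eq_mul, mul_left_comm]; exact Ideal.mul_mem_left _ _ hr

theorem exists_prod_pow_smul_eq_of_mem_cechBoundaries {z : CechTerm x}
    (hz : z ∈ cechBoundaries x) :
    ∃ (s : ℕ) (r : R), r ∈ (powIdeal x Finset.univ fun _ => s) ∧
      (∏ j, x j) ^ s • z = algebraMap R (CechTerm x) r := by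
  -- Two elements are added by moving to the common exponent `s + s'`, so these `z` form a submodule
  -- and only the generators need checking.
  let W : Submodule R (CechTerm x) :=
    { carrier := {z | ∃ (s : ℕ) (r : R), r ∈ (powIdeal x Finset.univ fun _ => s) ∧
        (∏ j, x j) ^ s • z = algebraMap R (CechTerm x) r}
      zero_mem' := ⟨0, 0, Ideal.zero_mem _, by simp⟩
      add_mem' := by
        rintro z w ⟨s, r, hr, hz⟩ ⟨s', r', hr', hw⟩
        refine ⟨s + s', (∏ j, x j) ^ s' * r + (∏ j, x j) ^ s * r',
          Ideal.add_mem _ ?_ (prod_pow_mul_mem_powIdeal x s hr'), ?_⟩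
        · rw [add_comm]
          exact prod_pow_mul_mem_powIdeal x s' hr
        · rw [smul_add, map_add, map_mul, map_mul, ← hz, ← hw, ← Algebra.smul_def,
            ← Algebra.smul_def, smul_smul, smul_smul, ← pow_add, ← pow_add, add_comm s']
      smul_mem' := by
        rintro a z ⟨s, r, hr, hz⟩
        refine ⟨s, a * r, Ideal.mul_mem_left _ _ hr, ?_⟩
        rw [smul_comm, hz, map_mul, Algebra.smul_def] }
  suffices h : cechBoundaries x ≤ W from h hz
  refine iSup_le fun i => Submodule.span_le.2 ?_
  rintro z ⟨k, r, hz⟩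
  refine ⟨k, x i ^ k * r,
    Ideal.mul_mem_right _ _ (pow_mem_powIdeal x (fun _ => k) (Finset.mem_univ i)), ?_⟩
  rw [prod_pow_smul_eq_pow_smul x i, hz, map_mul, Algebra.smul_def]

variable {x}

/-- `Hⁿ` is the increasing union of the `R/(x_i^t)`. This turns later statements about `Hⁿ` into
ideal membership in `R`. -/
theorem IsStronglyRegular.cechFrac_eq_zero_iff (hx : IsStronglyRegular x) {r : R} {t : ℕ} :
    cechFrac x r t = 0 ↔ r ∈ powIdeal x Finset.univ fun _ => t := by
  refine ⟨fun h => ?_, cechFrac_eq_zero_of_mem x⟩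
  obtain ⟨s, r', hr', hs⟩ :=
    exists_prod_pow_smul_eq_of_mem_cechBoundaries x ((Submodule.Quotient.mk_eq_zero _).1 h)
  have h1 : algebraMap R (CechTerm x) ((∏ j, x j) ^ s * r) =
      algebraMap R (CechTerm x) ((∏ j, x j) ^ t * r') := by
    rw [map_mul, map_mul, ← hs, ← Algebra.smul_def, ← Algebra.smul_def,
      ← prod_pow_smul_mk' x r t, smul_comm]
  obtain ⟨⟨_, k, rfl⟩, hk⟩ := (IsLocalization.eq_iff_exists (Submonoid.powers (∏ j, x j)) _).1 h1
  have hmem := prod_pow_mul_mem_powIdeal x (k + t) hr'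
  refine hx.mem_powIdeal_of_prod_pow_mul_mem (U := Finset.univ) le_rfl (k + s) ?_
  have he : (∏ j, x j) ^ (k + s) * r = (∏ j, x j) ^ (k + t) * r' := by
    rw [pow_add, pow_add, mul_assoc, mul_assoc]
    exact hk
  rw [he]
  simpa [add_comm, add_left_comm, add_assoc] using hmem

variable (p : ℕ) [Fact p.Prime] [CharP R p]

theorem topLocalCohomologyFrobenius_cechFrac (r : R) (t : ℕ) :
    topLocalCohomologyFrobenius p x (cechFrac x r t) = cechFrac x (r ^ p) (t * p) := by
  rw [cechFrac, cechFrac, topLocalCohomologyFrobenius, Submodule.mkQ_apply, Submodule.mapQ_apply]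
  rw [← Submodule.mkQ_apply]
  congr 1
  refine eq_mk'_of_prod_pow_smul_eq x ?_
  rw [← cechTermFrobenius_algebraMap, ← prod_pow_smul_mk' x r t, LinearMap.map_smulₛₗ,
    frobenius_def, pow_mul]

theorem iterate_topLocalCohomologyFrobenius_cechFrac (e : ℕ) (r : R) (t : ℕ) :
    (topLocalCohomologyFrobenius p x)^[e] (cechFrac x r t) =
      cechFrac x (r ^ p ^ e) (t * p ^ e) := by
  induction e with
  | zero => simp
  | succ e ih =>
    rw [Function.iterate_succ_apply', ih, topLocalCohomologyFrobenius_cechFrac, ← pow_mul,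
      ← pow_succ, mul_assoc, ← pow_succ]

end CechFractions

/-! ### Socle and first Koszul cohomology of `Hⁿ`. -/

section Koszul

variable {R : Type*} [CommRing R] {n : ℕ} {x : Fin n → R}

/-- Computes the colon `(x_1^(t+1), …, x_n^(t+1)) : (x_j, j ∈ S)`. Adding `i` to `S`, the relation
on `x_i r` says that `x_i c` lies in the ideal with exponents `1` on `S` and `t + 1` elsewhere, so
`c` is a multiple of `x_i^t` up to a term that `(∏_S x_j)^t` absorbs. -/
theorem IsStronglyRegular.mem_span_prod_sup_powIdeal (hx : IsStronglyRegular x) {t : ℕ} {r : R}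
    (S : Finset (Fin n)) (h : ∀ j ∈ S, x j * r ∈ powIdeal x Finset.univ fun _ => t + 1) :
    ∃ c, r - c * (∏ j ∈ S, x j) ^ t ∈ powIdeal x Finset.univ fun _ => t + 1 := by
  induction S using Finset.induction_on with
  | empty => exact ⟨r, by simp⟩
  | insert i S hi ih =>
    obtain ⟨c, hc⟩ := ih fun j hj => h j (Finset.mem_insert_of_mem hj)
    have h1 : (∏ j ∈ S, x j) ^ t * (x i * c) ∈ powIdeal x Finset.univ fun _ => t + 1 := by
      have : (∏ j ∈ S, x j) ^ t * (x i * c) =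
        x i * r - x i * (r - c * (∏ j ∈ S, x j) ^ t) := by ring
      rw [this]
      exact Ideal.sub_mem _ (h i (Finset.mem_insert_self i S)) (Ideal.mul_mem_left _ _ hc)
    have h2 : x i * c ∈ powIdeal x Finset.univ fun j => if j ∈ S then 1 else t + 1 := by
      refine hx.mem_powIdeal_of_prod_pow_mul_mem (Finset.subset_univ S) t ?_
      rwa [powIdeal_congr x (b := fun _ => t + 1)]
      intro j _
      by_cases hj : j ∈ S
      · simp [hj, add_comm]
      · simp [hj]
    have h3 := hx.mem_powIdeal_update_of_mul_mem (Finset.mem_univ i) (t := t) (by simp [hi]) h2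
    rw [← Finset.insert_erase (Finset.mem_univ i),
      powIdeal_insert_update x _ (Finset.notMem_erase i _)] at h3
    obtain ⟨_, hy, z, hz, rfl⟩ := Submodule.mem_sup.1 h3
    obtain ⟨d, rfl⟩ := Ideal.mem_span_singleton'.1 hy
    refine ⟨d, ?_⟩
    have hz' : (∏ j ∈ S, x j) ^ t * z ∈ powIdeal x Finset.univ fun _ => t + 1 := by
      clear hc h1 h2 h3
      induction hz using Submodule.span_induction with
      | mem y hy =>
        obtain ⟨j, -, rfl⟩ := hy
        refine Ideal.mem_of_dvd _ ?_ (pow_mem_powIdeal x (fun _ => t + 1) (Finset.mem_univ j))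
        by_cases hj : j ∈ S
        · simp only [hj, if_true, pow_succ, pow_zero, one_mul]
          exact mul_dvd_mul_right (pow_dvd_pow_of_dvd (Finset.dvd_prod_of_mem x hj) t) _
        · simp [hj]
      | zero => rw [mul_zero]; exact Ideal.zero_mem _
      | add r s _ _ hr hs => rw [mul_add]; exact Ideal.add_mem _ hr hs
      | smul a r _ hr => rw [smul_eq_mul, mul_left_comm]; exact Ideal.mul_mem_left _ _ hr
    have : r - d * (∏ j ∈ insert i S, x j) ^ t =
        (r - (d * x i ^ t + z) * (∏ j ∈ S, x j) ^ t) + (∏ j ∈ S, x j) ^ t * z := by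
      rw [Finset.prod_insert hi]; ring
    rw [this]
    exact Ideal.add_mem _ hc hz'

/-- An element of `Hⁿ` killed by `x j`, `j ∈ S`, has a representative with numerator divisible by
the corresponding `x j ^ t`. -/
theorem IsStronglyRegular.exists_eq_cechFrac_of_smul_eq_zero (hx : IsStronglyRegular x)
    {S : Finset (Fin n)} {z : TopLocalCohomology x} (h : ∀ j ∈ S, x j • z = 0) :
    ∃ (c : R) (t : ℕ), z = cechFrac x (c * (∏ j ∈ S, x j) ^ t) (t + 1) := by
  obtain ⟨r, t, rfl⟩ := exists_eq_cechFrac x z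
  rw [← cechFrac_mul_prod_pow x r t 1] at h ⊢
  obtain ⟨c, hc⟩ := hx.mem_span_prod_sup_powIdeal (t := t) S fun j hj => by
    have := h j hj
    rwa [smul_cechFrac, hx.cechFrac_eq_zero_iff] at this
  refine ⟨c, t, ?_⟩
  rw [← sub_add_cancel (r * (∏ j, x j) ^ 1) (c * (∏ j ∈ S, x j) ^ t), cechFrac_add,
    cechFrac_eq_zero_of_mem x hc, zero_add]

theorem IsStronglyRegular.exists_smul_eq_of_smul_eq_zero (hx : IsStronglyRegular x)
    {S : Finset (Fin n)} {i : Fin n} (hi : i ∉ S) {z : TopLocalCohomology x}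
    (h : ∀ j ∈ S, x j • z = 0) : ∃ y, x i • y = z ∧ ∀ j ∈ S, x j • y = 0 := by
  obtain ⟨c, t, rfl⟩ := hx.exists_eq_cechFrac_of_smul_eq_zero h
  have hP : (∏ j, x j) = x i * ((∏ j ∈ S, x j) * ∏ j ∈ (insert i S)ᶜ, x j) := by
    rw [← mul_assoc, ← Finset.prod_insert hi, Finset.prod_mul_prod_compl]
  -- Extend the fraction by the product of all parameters, then drop the factor `x_i` from the
  -- numerator. For `j ∈ S` the numerator keeps `x_j^(t+1)`, so one more `x_j` kills the class.
  refine ⟨cechFrac x (c * (∏ j ∈ S, x j) ^ (t + 1) * ∏ j ∈ (insert i S)ᶜ, x j) (t + 1 + 1),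
    ?_, fun j hj => ?_⟩
  · rw [smul_cechFrac, ← cechFrac_mul_prod_pow x _ (t + 1) 1, hP]
    congr 1
    ring
  · rw [smul_cechFrac]
    refine cechFrac_eq_zero_of_mem x (Ideal.mem_of_dvd _ ?_
      (pow_mem_powIdeal x (fun _ => t + 1 + 1) (Finset.mem_univ j)))
    have h1 : x j ^ (t + 1) ∣ (∏ j ∈ S, x j) ^ (t + 1) :=
      pow_dvd_pow_of_dvd (Finset.dvd_prod_of_mem x hj) _
    obtain ⟨d, hd⟩ := h1
    exact ⟨c * d * ∏ j ∈ (insert i S)ᶜ, x j, by rw [hd]; ring⟩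

/-- The first Koszul cohomology of `Hⁿ` vanishes. -/
theorem IsStronglyRegular.exists_forall_smul_eq (hx : IsStronglyRegular x)
    (h : Fin n → TopLocalCohomology x) (hcomm : ∀ i j, x i • h j = x j • h i) :
    ∃ y, ∀ i, x i • y = h i := by
  suffices key : ∀ S : Finset (Fin n), ∃ y, ∀ i ∈ S, x i • y = h i by
    obtain ⟨y, hy⟩ := key Finset.univ
    exact ⟨y, fun i => hy i (Finset.mem_univ i)⟩
  intro S
  induction S using Finset.induction_on with
  | empty => exact ⟨0, by simp⟩
  | insert i S hi ih =>
    obtain ⟨y, hy⟩ := ih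
    -- Compatibility of `h` makes the error at `i` vanish under `x_j`, `j ∈ S`, so it can be divided
    -- by `x_i` without disturbing the equations already solved.
    obtain ⟨w, hw, hw0⟩ := hx.exists_smul_eq_of_smul_eq_zero hi (z := h i - x i • y)
      fun j hj => by rw [smul_sub, smul_comm, hy j hj, hcomm j i, sub_self]
    refine ⟨y + w, fun j hj => ?_⟩
    rcases Finset.mem_insert.1 hj with rfl | hj
    · rw [smul_add, hw, add_sub_cancel]
    · rw [smul_add, hw0 j hj, add_zero, hy j hj]

theorem IsStronglyRegular.exists_eq_smul_cechFrac_one (hx : IsStronglyRegular x)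
    {z : TopLocalCohomology x} (h : ∀ j, x j • z = 0) : ∃ c : R, z = c • cechFrac x 1 1 := by
  obtain ⟨c, t, rfl⟩ := hx.exists_eq_cechFrac_of_smul_eq_zero (S := Finset.univ) fun j _ => h j
  refine ⟨c, ?_⟩
  rw [smul_cechFrac, mul_one, add_comm, cechFrac_mul_prod_pow]

theorem exists_pow_smul_eq_zero (z : TopLocalCohomology x) (i : Fin n) :
    ∃ k : ℕ, x i ^ k • z = 0 := by
  obtain ⟨r, t, rfl⟩ := exists_eq_cechFrac x z
  refine ⟨t, ?_⟩
  rw [smul_cechFrac]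
  exact cechFrac_eq_zero_of_mem x
    (Ideal.mul_mem_right _ _ (pow_mem_powIdeal x (fun _ => t) (Finset.mem_univ i)))

end Koszul

/-! ### Injective hulls of the residue field and `Hⁿ`. -/

section InjectiveHull

open IsLocalRing

/-- A nonzero cyclic submodule of the torsion module `M/N` meets its socle: for each `i` in turn,
multiply by the last power of `x_i` that stays outside `N`. -/
theorem exists_smul_notMem_of_pow_smul_eq_zero {R M : Type*} [CommRing R] [AddCommGroup M]
    [Module R M] {n : ℕ} {x : Fin n → R} (htors : ∀ (z : M) (i : Fin n), ∃ k : ℕ, x i ^ k • z = 0)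
    {N : Submodule R M} {z : M} (hz : z ∉ N) : ∃ c : R, c • z ∉ N ∧ ∀ i, x i • c • z ∈ N := by
  classical
  suffices key : ∀ S : Finset (Fin n), ∃ c : R, c • z ∉ N ∧ ∀ i ∈ S, x i • c • z ∈ N by
    obtain ⟨c, hc, h⟩ := key Finset.univ
    exact ⟨c, hc, fun i => h i (Finset.mem_univ i)⟩
  intro S
  induction S using Finset.induction_on with
  | empty => exact ⟨1, by simpa using hz⟩
  | insert i S _ ih =>
    obtain ⟨c, hc, h⟩ := ih
    have hex : ∃ k : ℕ, x i ^ k • c • z ∈ N := by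
      obtain ⟨k, hk⟩ := htors (c • z) i
      exact ⟨k, hk ▸ N.zero_mem⟩
    obtain ⟨k, hk⟩ : ∃ k, Nat.find hex = k + 1 := by
      refine Nat.exists_eq_succ_of_ne_zero fun h0 => hc ?_
      simpa [h0] using Nat.find_spec hex
    refine ⟨x i ^ k * c, ?_, fun j hj => ?_⟩
    · rw [mul_smul]
      exact Nat.find_min hex (by omega)
    · rcases Finset.mem_insert.1 hj with rfl | hj
      · have := Nat.find_spec hex
        rwa [hk, pow_succ', mul_smul, ← mul_smul _ c] at this
      · rw [mul_smul, smul_comm]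
        exact N.smul_mem _ (h j hj)

variable {R : Type u} [CommRing R] [IsLocalRing R] {E : Type u} [AddCommGroup E] [Module R E]
  {ι : ResidueField R →ₗ[R] E}

theorem smul_residueField_eq_zero {a : R} (ha : a ∈ maximalIdeal R) (w : ResidueField R) :
    a • w = 0 := by
  rw [Algebra.smul_def, ResidueField.algebraMap_eq, (residue_eq_zero_iff a).2 ha, zero_mul]

namespace IsInjectiveHull

theorem exists_smul_eq (hE : IsInjectiveHull R ι) {z : E} (hz : z ≠ 0) :
    ∃ (c : R) (w : ResidueField R), c • z = ι w ∧ c • z ≠ 0 := by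
  have h : Submodule.span R {z} ⊓ LinearMap.range ι ≠ ⊥ := fun h =>
    hz (Submodule.span_singleton_eq_bot.1 (hE.essential _ h))
  obtain ⟨y, ⟨hy1, w, rfl⟩, hy0⟩ := Submodule.exists_mem_ne_zero_of_ne_bot h
  obtain ⟨c, hc⟩ := Submodule.mem_span_singleton.1 hy1
  exact ⟨c, w, hc, hc ▸ hy0⟩

/-- The annihilators of `a^k z` stabilise. If `a^k z ≠ 0` for such a `k`, some nonzero multiple `c
a^k z` lies in the residue field, so `a` kills it; then `c` annihilates `a^(k+1) z` and hence `a^k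
z`, a contradiction. -/
theorem exists_pow_smul_eq_zero [IsNoetherianRing R] (hE : IsInjectiveHull R ι) {a : R}
    (ha : a ∈ maximalIdeal R) (z : E) : ∃ k : ℕ, a ^ k • z = 0 := by
  let A : ℕ →o Submodule R R :=
    { toFun := fun k => LinearMap.ker (LinearMap.toSpanSingleton R E (a ^ k • z))
      monotone' := by
        refine monotone_nat_of_le_succ fun k c hc => ?_
        simp only [LinearMap.mem_ker, LinearMap.toSpanSingleton_apply] at hc ⊢
        rw [pow_succ', mul_smul, smul_comm, hc, smul_zero] }
  obtain ⟨k, hk⟩ := monotone_stabilizes_iff_noetherian.2 (inferInstanceAs (IsNoetherian R R)) A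
  refine ⟨k, by_contra fun hne => ?_⟩
  obtain ⟨c, w, hcw, hc0⟩ := hE.exists_smul_eq hne
  apply hc0
  have h1 : c ∈ A (k + 1) := by
    change c • a ^ (k + 1) • z = 0
    rw [pow_succ', mul_smul, smul_comm, hcw, ← map_smul, smul_residueField_eq_zero ha, map_zero]
  rw [← hk (k + 1) (Nat.le_succ k)] at h1
  exact h1

theorem mem_range_of_smul_eq_zero (hE : IsInjectiveHull R ι) {z : E}
    (hz : ∀ a ∈ maximalIdeal R, a • z = 0) : z ∈ LinearMap.range ι := by
  by_cases h0 : z = 0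
  · rw [h0]; exact zero_mem _
  obtain ⟨c, w, hcw, hc0⟩ := hE.exists_smul_eq h0
  have hc : IsUnit c := by
    by_contra hc
    exact hc0 (hz c hc)
  rw [← Submodule.smul_mem_iff_of_isUnit _ hc, hcw]
  exact ⟨w, rfl⟩

/-- The injective hull of the residue field is a cogenerator. -/
theorem exists_smul_ne_zero (hE : IsInjectiveHull R ι) {J : Ideal R} {a : R} (ha : a ∉ J) :
    ∃ z : E, (∀ c ∈ J, c • z = 0) ∧ a • z ≠ 0 := by
  -- The kernel is `(J : a) ≤ 𝔪`, so `R/(J : a)` embeds in `R/J` by `1 ↦ a` and maps to `E` by `1 ↦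
  -- ι 1`. Extending that map to `R/J`, the image of `1` is the required `z`.
  let f₀ : R →ₗ[R] R ⧸ J := LinearMap.toSpanSingleton R (R ⧸ J) (Ideal.Quotient.mk J a)
  have hker : LinearMap.ker f₀ ≤ maximalIdeal R := by
    refine le_maximalIdeal fun h => ha ?_
    have : (1 : R) ∈ LinearMap.ker f₀ := h ▸ trivial
    rw [LinearMap.mem_ker, LinearMap.toSpanSingleton_apply, one_smul] at this
    exact Ideal.Quotient.eq_zero_iff_mem.1 this
  let g : (R ⧸ LinearMap.ker f₀) →ₗ[R] E := (LinearMap.ker f₀).liftQ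
    (LinearMap.toSpanSingleton R E (ι 1)) fun c hc => by
      rw [LinearMap.mem_ker, LinearMap.toSpanSingleton_apply, ← map_smul,
        smul_residueField_eq_zero (hker hc), map_zero]
  let f : (R ⧸ LinearMap.ker f₀) →ₗ[R] R ⧸ J := (LinearMap.ker f₀).liftQ f₀ le_rfl
  have hf : Function.Injective f :=
    LinearMap.ker_eq_bot.1 (Submodule.ker_liftQ_eq_bot _ _ _ le_rfl)
  obtain ⟨h, hh⟩ := hE.injective_module.out f hf g
  refine ⟨h (Ideal.Quotient.mk J 1), fun c hc => ?_, ?_⟩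
  · rw [← map_smul]
    have : c • Ideal.Quotient.mk J 1 = 0 := by
      rw [Algebra.smul_def, map_one, mul_one]
      exact Ideal.Quotient.eq_zero_iff_mem.2 hc
    rw [this, map_zero]
  · have h1 := hh (Submodule.Quotient.mk 1)
    have h2 : f (Submodule.Quotient.mk 1) = a • Ideal.Quotient.mk J 1 := by
      change (1 : R) • Ideal.Quotient.mk J a = _
      rw [one_smul, Algebra.smul_def, map_one, mul_one]
      rfl
    have h3 : g (Submodule.Quotient.mk 1) = ι 1 := one_smul R _
    rw [h2, map_smul, h3] at h1
    rw [h1]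
    intro h0
    exact one_ne_zero (hE.injective_map (h0.trans (map_zero ι).symm))

variable {n : ℕ} {x : Fin n → R}

theorem _root_.smul_eq_zero_of_span_range (hx : Ideal.span (Set.range x) = maximalIdeal R)
    {M : Type*} [AddCommGroup M] [Module R M] {z : M} (hz : ∀ i, x i • z = 0) {a : R}
    (ha : a ∈ maximalIdeal R) : a • z = 0 := by
  rw [← hx] at ha
  have : Ideal.span (Set.range x) ≤ LinearMap.ker (LinearMap.toSpanSingleton R M z) := by
    rw [Ideal.span_le]
    rintro _ ⟨i, rfl⟩
    exact hz i
  exact this ha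

theorem _root_.IsStronglyRegular.smul_cechFrac_one_ne_zero (hreg : IsStronglyRegular x)
    (hx : Ideal.span (Set.range x) = maximalIdeal R) {c : R} (hc : c ∉ maximalIdeal R) :
    c • cechFrac x 1 1 ≠ 0 := by
  rw [smul_cechFrac, mul_one, Ne, hreg.cechFrac_eq_zero_iff, powIdeal]
  simpa [hx] using hc

/-- `Hⁿ` computed by a regular system of parameters is an injective hull of the residue field. -/
theorem exists_linearEquiv_topLocalCohomology [IsNoetherianRing R] (hE : IsInjectiveHull R ι)
    (hx : Ideal.span (Set.range x) = maximalIdeal R) (hreg : IsStronglyRegular x) :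
    Nonempty (E ≃ₗ[R] TopLocalCohomology x) := by
  have hxm := mem_maximalIdeal_of_span_range hx
  have hsoc : ∀ i, x i • cechFrac x 1 1 = 0 := fun i => by
    rw [smul_cechFrac]
    refine cechFrac_eq_zero_of_mem x (Ideal.mul_mem_right _ _ ?_)
    simpa using pow_mem_powIdeal x (fun _ => 1) (Finset.mem_univ i)
  let f : (R ⧸ maximalIdeal R) →ₗ[R] TopLocalCohomology x := (maximalIdeal R).liftQ
    (LinearMap.toSpanSingleton R _ (cechFrac x 1 1)) fun a ha => smul_eq_zero_of_span_range hx hsoc ha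
  have hf : Function.Injective f := by
    refine LinearMap.ker_eq_bot.1 (Submodule.ker_liftQ_eq_bot _ _ _ fun c hc => ?_)
    by_contra hcm
    exact hreg.smul_cechFrac_one_ne_zero hx hcm hc
  -- Only injectivity of `E` is used: `ι` extends along the embedding of the residue field as the
  -- socle of `Hⁿ`, generated by `[1/(x_1⋯x_n)]`.
  obtain ⟨ψ, hψ⟩ := hE.injective_module.out f hf ι
  have hψ1 : ψ (cechFrac x 1 1) = ι 1 := by
    have := hψ (Submodule.Quotient.mk 1)
    have hf1 : f (Submodule.Quotient.mk 1) = cechFrac x 1 1 :=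
      one_smul R (cechFrac x 1 1)
    rwa [hf1] at this
  have hι : LinearMap.range ι ≤ LinearMap.range ψ := by
    rintro _ ⟨w, rfl⟩
    exact ⟨f w, hψ w⟩
  have hinj : Function.Injective ψ := by
    rw [← LinearMap.ker_eq_bot, Submodule.eq_bot_iff]
    intro z hz
    by_contra hz0
    obtain ⟨c, hc, h⟩ := exists_smul_notMem_of_pow_smul_eq_zero
      (N := (⊥ : Submodule R (TopLocalCohomology x))) _root_.exists_pow_smul_eq_zero
      (z := z) (by simpa using hz0)
    obtain ⟨d, hd⟩ := hreg.exists_eq_smul_cechFrac_one (z := c • z) fun j => by simpa using h j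
    have h1 : ψ (c • z) = 0 := by rw [map_smul, LinearMap.mem_ker.1 hz, smul_zero]
    rw [hd, map_smul, hψ1, ← map_smul] at h1
    have h2 : d • (1 : ResidueField R) = 0 := hE.injective_map (h1.trans (map_zero ι).symm)
    apply hc
    rw [hd, Submodule.mem_bot]
    refine smul_eq_zero_of_span_range hx hsoc ?_
    rwa [Algebra.smul_def, mul_one, ResidueField.algebraMap_eq, residue_eq_zero_iff] at h2
  -- A socle element `c z` of `E / range ψ` has `x_i c z = ψ y_i` with compatible `y_i`. Koszul
  -- vanishing gives one `w` with `x_i w = y_i`, and `c z - ψ w` is in the socle of `E`, that is, in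
  -- `range ι ≤ range ψ`.
  have hsurj : Function.Surjective ψ := by
    rw [← LinearMap.range_eq_top, eq_top_iff]
    by_contra hne
    obtain ⟨z, -, hz⟩ := SetLike.not_le_iff_exists.1 hne
    obtain ⟨c, hc, h⟩ := exists_smul_notMem_of_pow_smul_eq_zero
      (fun z i => hE.exists_pow_smul_eq_zero (hxm i) z) hz
    choose y hy using h
    obtain ⟨w, hw⟩ := hreg.exists_forall_smul_eq y fun i j => hinj (by
      rw [map_smul, map_smul, hy, hy, smul_comm])
    have h1 : c • z - ψ w ∈ LinearMap.range ι := by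
      refine hE.mem_range_of_smul_eq_zero fun a ha => smul_eq_zero_of_span_range hx (fun i => ?_) ha
      rw [smul_sub, ← map_smul, hw, hy, sub_self]
    apply hc
    rw [← sub_add_cancel (c • z) (ψ w)]
    exact add_mem (hι h1) ⟨w, rfl⟩
  exact ⟨(LinearEquiv.ofBijective ψ ⟨hinj, hsurj⟩).symm⟩

end IsInjectiveHull

theorem isStronglyRegular_of_span_range [IsNoetherianRing R] {n : ℕ} {x : Fin n → R}
    (hx : Ideal.span (Set.range x) = maximalIdeal R) (hdim : ringKrullDim R = n) :
    IsStronglyRegular x :=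
  fun _ _ hi _ h => mem_span_image_of_mul_mem hx hdim hi h

theorem exists_regular_system_of_parameters (R : Type*) [CommRing R] [IsRegularLocalRing R] :
    ∃ (n : ℕ) (x : Fin n → R), ringKrullDim R = n ∧
      Ideal.span (Set.range x) = maximalIdeal R := by
  have hfg : (maximalIdeal R).FG := IsNoetherian.noetherian _
  have := (Submodule.FG.finite_generators hfg).to_subtype
  let e := Finite.equivFin (maximalIdeal R).generators
  refine ⟨_, fun i => e.symm i, ?_, ?_⟩
  · rw [← IsRegularLocalRing.spanFinrank_maximalIdeal, ← Submodule.FG.generators_ncard hfg]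
    rfl
  · have : Set.range (fun i => (e.symm i : R)) = (maximalIdeal R).generators := by
      rw [← Function.comp_def, Set.range_comp, e.symm.range_eq_univ, Set.image_univ,
        Subtype.range_coe]
    rw [this]
    exact Submodule.span_generators _

theorem IsInjectiveHull.exists_isNaturalPLinearStructure {R : Type u} [CommRing R]
    [IsRegularLocalRing R] (p : ℕ) [Fact p.Prime] [CharP R p] {E : Type u} [AddCommGroup E]
    [Module R E] {ι : ResidueField R →ₗ[R] E} (hE : IsInjectiveHull R ι) :
    ∃ F : E →ₛₗ[frobenius R p] E, IsNaturalPLinearStructure p F := by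
  obtain ⟨n, x, hdim, hx⟩ := exists_regular_system_of_parameters R
  obtain ⟨φ⟩ := hE.exists_linearEquiv_topLocalCohomology hx
    (isStronglyRegular_of_span_range hx hdim)
  refine ⟨φ.symm.toLinearMap.comp ((topLocalCohomologyFrobenius p x).comp φ.toLinearMap),
    n, x, hdim, hx, φ, fun z => ?_⟩
  exact φ.apply_symm_apply _

end InjectiveHull

/-! ### Bases over the Frobenius and Frobenius roots. -/

section FrobeniusExpansion

variable {R : Type*} [CommRing R] (p : ℕ) [Fact p.Prime] [CharP R p]

theorem finite_iterateFrobenius (hfin : (frobenius R p).Finite) (e : ℕ) :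
    (iterateFrobenius R p e).Finite := by
  induction e with
  | zero => rw [iterateFrobenius_zero]; exact RingHom.Finite.id R
  | succ e ih =>
    rw [iterateFrobenius_add, iterateFrobenius_one]
    exact ih.comp hfin

/-- `b` is a basis of `R` over the subring of `p ^ e`-th powers, coefficients being uniquely
determined up to their `p ^ e`-th powers. -/
structure IsFrobeniusBasis (e : ℕ) {k : ℕ} (b : Fin k → R) : Prop where
  exists_eq_sum : ∀ s, ∃ c : Fin k → R, s = ∑ j, iterateFrobenius R p e (c j) * b j
  eq_zero : ∀ c : Fin k → R, ∑ j, iterateFrobenius R p e (c j) * b j = 0 → ∀ j, c j = 0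

variable {p}

/-- The regularity required for freeness is that of the `x_i^(p^e)`, a case of `powIdeal` with
constant exponent. -/
theorem IsStronglyRegular.exists_isFrobeniusBasis [IsLocalRing R] [IsNoetherianRing R]
    (hfin : (frobenius R p).Finite) {n : ℕ} {x : Fin n → R} (hreg : IsStronglyRegular x)
    (hx : Ideal.span (Set.range x) = IsLocalRing.maximalIdeal R) (e : ℕ) :
    ∃ (k : ℕ) (b : Fin k → R), IsFrobeniusBasis p e b := by
  obtain ⟨k, b, h1, h2⟩ := RingHom.Finite.exists_basis_of_regular hx (iterateFrobenius R p e)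
    (finite_iterateFrobenius p hfin e) fun S i hi r h =>
      hreg.mem_powIdeal_of_pow_mul_mem (a := fun _ => p ^ e) hi (p ^ e) h
  exact ⟨k, b, h1, h2⟩

namespace IsFrobeniusBasis

variable {e k : ℕ} {b : Fin k → R} (hb : IsFrobeniusBasis p e b)

include hb

theorem eq_of_sum_eq {c d : Fin k → R} (h : ∑ j, iterateFrobenius R p e (c j) * b j =
    ∑ j, iterateFrobenius R p e (d j) * b j) (j : Fin k) : c j = d j := by
  refine sub_eq_zero.1 (hb.eq_zero (fun j => c j - d j) ?_ j)
  simp_rw [map_sub, sub_mul]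
  rw [Finset.sum_sub_distrib, h, sub_self]

theorem exists_sum_of_mem_frobeniusPower {K : Ideal R} {s : R}
    (hs : s ∈ frobeniusPower K (p ^ e)) :
    ∃ d : Fin k → R, (∀ j, d j ∈ K) ∧ s = ∑ j, iterateFrobenius R p e (d j) * b j := by
  choose c hc using hb.exists_eq_sum
  induction hs using Submodule.span_induction with
  | mem s hs =>
    obtain ⟨h, hK, rfl⟩ := hs
    refine ⟨fun j => h * c 1 j, fun j => Ideal.mul_mem_right _ _ hK, ?_⟩
    simp_rw [map_mul, mul_assoc]
    rw [← Finset.mul_sum, ← hc 1, mul_one, iterateFrobenius_def]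
  | zero => exact ⟨0, fun _ => Ideal.zero_mem _, by simp⟩
  | add s t _ _ hs ht =>
    obtain ⟨d, hd, rfl⟩ := hs
    obtain ⟨d', hd', rfl⟩ := ht
    refine ⟨d + d', fun j => Ideal.add_mem _ (hd j) (hd' j), ?_⟩
    simp_rw [Pi.add_apply, map_add, add_mul]
    rw [Finset.sum_add_distrib]
  | smul a s _ hs =>
    obtain ⟨d, hd, rfl⟩ := hs
    refine ⟨fun l => ∑ j, d j * c (a * b j) l,
      fun l => Ideal.sum_mem _ fun j _ => Ideal.mul_mem_right _ _ (hd j), ?_⟩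
    simp_rw [map_sum, map_mul, Finset.sum_mul]
    rw [Finset.sum_comm, smul_eq_mul, Finset.mul_sum]
    refine Finset.sum_congr rfl fun j _ => ?_
    simp_rw [mul_assoc]
    rw [← Finset.mul_sum, ← hc (a * b j), mul_left_comm]

theorem mem_of_sum_mem_frobeniusPower {K : Ideal R} {c : Fin k → R}
    (h : ∑ j, iterateFrobenius R p e (c j) * b j ∈ frobeniusPower K (p ^ e)) (j : Fin k) :
    c j ∈ K := by
  obtain ⟨d, hd, h⟩ := hb.exists_sum_of_mem_frobeniusPower h
  rw [hb.eq_of_sum_eq h j]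
  exact hd j

/-- Leastness is the uniqueness of coefficients: `g ∈ K^[q]` has an expansion with coefficients in
`K`, which must be the `c j`. -/
theorem isFrobeniusRoot {g : R} {c : Fin k → R}
    (hg : g = ∑ j, iterateFrobenius R p e (c j) * b j) :
    IsFrobeniusRoot (Ideal.span {g}) (p ^ e) (Ideal.span (Set.range c)) := by
  refine ⟨?_, fun K hK => ?_⟩
  · rw [Set.mem_ofPred_eq, Ideal.span_singleton_le_iff_mem, hg]
    exact Ideal.sum_mem _ fun j _ => Ideal.mul_mem_right _ _
      (Ideal.subset_span ⟨c j, Ideal.subset_span ⟨j, rfl⟩, rfl⟩)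
  · rw [Set.mem_ofPred_eq, Ideal.span_singleton_le_iff_mem, hg] at hK
    rw [Ideal.span_le]
    rintro _ ⟨j, rfl⟩
    exact hb.mem_of_sum_mem_frobeniusPower hK j

/-- With a common denominator the hypothesis reads `∑ r_j^q b_j ∈ (x_i^(tq))`, an ideal inside
`(x_i^t)^[q]`; hence every `r_j ∈ (x_i^t)`. -/
theorem eq_zero_of_sum_cechFrac_eq_zero {n : ℕ} {x : Fin n → R} (hreg : IsStronglyRegular x)
    (z : Fin k → TopLocalCohomology x)
    (h : ∑ j, b j • (topLocalCohomologyFrobenius p x)^[e] (z j) = 0) (j : Fin k) : z j = 0 := by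
  obtain ⟨r, t, hr⟩ := exists_forall_eq_cechFrac x z
  simp_rw [hr, iterate_topLocalCohomologyFrobenius_cechFrac, smul_cechFrac] at h
  rw [← cechFrac_sum, hreg.cechFrac_eq_zero_iff] at h
  rw [hr, hreg.cechFrac_eq_zero_iff]
  refine hb.mem_of_sum_mem_frobeniusPower ?_ j
  have hle : (powIdeal x Finset.univ fun _ => t * p ^ e) ≤
      frobeniusPower (powIdeal x Finset.univ fun _ => t) (p ^ e) :=
    powIdeal_le.2 fun i hi => by
      rw [pow_mul]
      exact Ideal.subset_span ⟨_, pow_mem_powIdeal x (fun _ => t) hi, rfl⟩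
  simpa [iterateFrobenius_def, mul_comm] using hle h

end IsFrobeniusBasis

end FrobeniusExpansion

/-! ### Iterates of `p`-linear maps. -/

section PLinearMaps

variable {R : Type*} [CommRing R] {p : ℕ} [Fact p.Prime] [CharP R p] {E : Type*} [AddCommGroup E]
  [Module R E] {F : E →ₛₗ[frobenius R p] E}

theorem iterate_frobeniusSemilinear_smul (e : ℕ) (c : R) (z : E) :
    F^[e] (c • z) = c ^ p ^ e • F^[e] z := by
  induction e with
  | zero => simp
  | succ e ih =>
    rw [Function.iterate_succ_apply', ih, LinearMap.map_smulₛₗ, frobenius_def, ← pow_mul,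
      ← pow_succ, Function.iterate_succ_apply']

theorem iterate_pow_smul_frobeniusSemilinear (f : R) (i : ℕ) (z : E) :
    (f ^ (p - 1) • F : E →ₛₗ[frobenius R p] E)^[i] z = f ^ (p ^ i - 1) • F^[i] z := by
  induction i with
  | zero => simp
  | succ i ih =>
    rw [Function.iterate_succ_apply', ih, LinearMap.smul_apply, LinearMap.map_smulₛₗ,
      frobenius_def, smul_smul, ← pow_mul, ← pow_add, Function.iterate_succ_apply']
    congr 2
    have h1 : 1 ≤ p := (Fact.out : p.Prime).one_le
    have h2 : 1 ≤ p ^ i := Nat.one_le_pow _ _ h1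
    have h3 : 1 ≤ p ^ (i + 1) := Nat.one_le_pow _ _ h1
    zify [h1, h2, h3]
    ring

theorem mem_iterateKer_pow_smul_iff (f : R) (i : ℕ) (z : E) :
    z ∈ iterateKer (f ^ (p - 1) • F) i ↔ f ^ (p ^ i - 1) • F^[i] z = 0 := by
  rw [← iterate_pow_smul_frobeniusSemilinear]
  rfl

theorem smul_iterate_eq_zero_iff {e k : ℕ} {b : Fin k → R}
    (hinj : ∀ z : Fin k → E, ∑ j, b j • F^[e] (z j) = 0 → ∀ j, z j = 0) {g : R} {c : Fin k → R}
    (hg : g = ∑ j, iterateFrobenius R p e (c j) * b j) (z : E) :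
    g • F^[e] z = 0 ↔ ∀ j, c j • z = 0 := by
  have h : g • F^[e] z = ∑ j, b j • F^[e] (c j • z) := by
    rw [hg, Finset.sum_smul]
    refine Finset.sum_congr rfl fun j _ => ?_
    rw [iterate_frobeniusSemilinear_smul, smul_smul, iterateFrobenius_def, mul_comm]
  rw [h]
  refine ⟨hinj _, fun h0 => Finset.sum_eq_zero fun j _ => ?_⟩
  rw [h0, iterate_map_zero, smul_zero]

end PLinearMaps

/-! ### Annihilators of kernels and the test ideal. -/

section Annihilator

open IsLocalRing

variable {R : Type u} [CommRing R] [IsRegularLocalRing R] {p : ℕ} [Fact p.Prime] [CharP R p]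
  {E : Type u} [AddCommGroup E] [Module R E] {F : E →ₛₗ[frobenius R p] E}

/-- For the natural `p`-linear structure, `b ⊗ z ↦ b • F ^ e z` is injective. -/
theorem IsNaturalPLinearStructure.exists_isFrobeniusBasis (hfin : (frobenius R p).Finite)
    (hF : IsNaturalPLinearStructure p F) (e : ℕ) :
    ∃ (k : ℕ) (b : Fin k → R), IsFrobeniusBasis p e b ∧
      ∀ z : Fin k → E, ∑ j, b j • F^[e] (z j) = 0 → ∀ j, z j = 0 := by
  obtain ⟨n, x, hdim, hx, φ, hφ⟩ := hF
  have hreg := isStronglyRegular_of_span_range hx hdim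
  obtain ⟨k, b, hb⟩ := hreg.exists_isFrobeniusBasis hfin hx e
  refine ⟨k, b, hb, fun z hz j => ?_⟩
  have hsemi : Function.Semiconj φ F (topLocalCohomologyFrobenius p x) := hφ
  have h := hb.eq_zero_of_sum_cechFrac_eq_zero hreg (fun j => φ (z j)) (by
    have := congrArg φ hz
    rw [map_sum, map_zero] at this
    rw [← this]
    refine Finset.sum_congr rfl fun j _ => ?_
    rw [map_smul, (hsemi.iterate_right e).eq]) j
  exact φ.map_eq_zero_iff.1 h

/-- Expand `1` in the basis: some coefficient `c j` is a unit, otherwise `1 ∈ 𝔪`, and `F^e z = 0`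
forces `c j • z = 0`. -/
theorem IsNaturalPLinearStructure.iterate_eq_zero_iff (hfin : (frobenius R p).Finite)
    (hF : IsNaturalPLinearStructure p F) (e : ℕ) (z : E) : F^[e] z = 0 ↔ z = 0 := by
  refine ⟨fun h => ?_, fun h => by rw [h, iterate_map_zero]⟩
  obtain ⟨k, b, hb, hinj⟩ := hF.exists_isFrobeniusBasis hfin e
  obtain ⟨c, hc⟩ := hb.exists_eq_sum 1
  have hz := (smul_iterate_eq_zero_iff hinj hc z).1 (by rw [one_smul, h])
  obtain ⟨j, hj⟩ : ∃ j, IsUnit (c j) := by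
    by_contra! hnu
    refine (Ideal.ne_top_iff_one _).1 (maximalIdeal.isMaximal R).ne_top (hc ▸ ?_)
    refine Ideal.sum_mem _ fun j _ => Ideal.mul_mem_right _ _ ?_
    rw [iterateFrobenius_def]
    exact Ideal.pow_mem_of_mem _ (hnu j) _ (pow_pos (Fact.out : p.Prime).pos e)
  exact hj.smul_eq_zero.1 (hz j)

theorem IsNaturalPLinearStructure.isFrobeniusRoot_annihilator (hfin : (frobenius R p).Finite)
    {ι : ResidueField R →ₗ[R] E} (hE : IsInjectiveHull R ι)
    (hF : IsNaturalPLinearStructure p F) {e : ℕ} {g : R} {N : Submodule R E}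
    (hN : ∀ z, z ∈ N ↔ g • F^[e] z = 0) :
    IsFrobeniusRoot (Ideal.span {g}) (p ^ e) N.annihilator := by
  obtain ⟨k, b, hb, hinj⟩ := hF.exists_isFrobeniusBasis hfin e
  obtain ⟨c, hc⟩ := hb.exists_eq_sum g
  have hN' : ∀ z, z ∈ N ↔ ∀ j, c j • z = 0 := fun z =>
    (hN z).trans (smul_iterate_eq_zero_iff hinj hc z)
  have hann : N.annihilator = Ideal.span (Set.range c) := by
    refine le_antisymm (fun a ha => ?_) ?_
    · by_contra hac
      obtain ⟨z, hz, haz⟩ := hE.exists_smul_ne_zero hac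
      exact haz (Submodule.mem_annihilator.1 ha z
        ((hN' z).2 fun j => hz _ (Ideal.subset_span ⟨j, rfl⟩)))
    · rw [Ideal.span_le]
      rintro _ ⟨j, rfl⟩
      exact Submodule.mem_annihilator.2 fun z hz => (hN' z).1 hz j
  rw [hann]
  exact hb.isFrobeniusRoot hc

end Annihilator

theorem natCeil_pow_sub_one_div_pow_mul_pow {p : ℕ} (hp : 1 ≤ p) (i k : ℕ) :
    ⌈((p : ℝ) ^ i - 1) / (p : ℝ) ^ i * (p : ℝ) ^ (i + k)⌉₊ = (p ^ i - 1) * p ^ k := by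
  have h0 : (p : ℝ) ^ i ≠ 0 := pow_ne_zero _ (by exact_mod_cast (by omega : p ≠ 0))
  have : ((p : ℝ) ^ i - 1) / (p : ℝ) ^ i * (p : ℝ) ^ (i + k) = (((p ^ i - 1) * p ^ k : ℕ) : ℝ) := by
    rw [Nat.cast_mul, Nat.cast_sub (Nat.one_le_pow _ _ hp), pow_add]
    push_cast
    field_simp
  rw [this, Nat.ceil_natCast]

theorem proposition5p7 {R : Type u} [CommRing R] [IsRegularLocalRing R]
    (p : ℕ) [Fact p.Prime] [CharP R p] (hfin : (frobenius R p).Finite)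
    (f : R) (hf : f ≠ 0)
    {E : Type u} [AddCommGroup E] [Module R E]
    (ι : IsLocalRing.ResidueField R →ₗ[R] E) (hE : IsInjectiveHull R ι) :
    (∃ F : E →ₛₗ[frobenius R p] E, IsNaturalPLinearStructure p F) ∧
    ∀ F : E →ₛₗ[frobenius R p] E, IsNaturalPLinearStructure p F →
      ∀ i : ℕ, 1 ≤ i →
        IsTestIdeal p (Ideal.span {f}) (((p : ℝ) ^ i - 1) / (p : ℝ) ^ i)
          (iterateKer (f ^ (p - 1) • F) i).annihilator := by
  refine ⟨hE.exists_isNaturalPLinearStructure p, fun F hF i _ => ?_⟩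
  filter_upwards [eventually_ge_atTop i] with e he
  obtain ⟨k, rfl⟩ := Nat.exists_eq_add_of_le he
  rw [natCeil_pow_sub_one_div_pow_mul_pow (Fact.out : p.Prime).one_le, Ideal.span_singleton_pow]
  refine hF.isFrobeniusRoot_annihilator hfin hE fun z => ?_
  -- Apply the injective `F^k` to `f^(p^i-1) F^i z`: the scalar is raised to the power `p^k`,
  -- matching the exponent in the test ideal at level `i + k`.
  rw [mem_iterateKer_pow_smul_iff, ← hF.iterate_eq_zero_iff hfin k,
    iterate_frobeniusSemilinear_smul, ← pow_mul, ← Function.iterate_add_apply, add_comm k i]
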